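/- Theorem 1.5. Fix an integer $d\ge 1$ and write $\mathbb Z_+=\{0,1,2,\dots\}$. Let $\omega=(\omega_n)_{n\in\mathbb Z}$ be a stationary ergodic sequence with values in a measurable space $(\mathcal S,\mathcal B)$, let $P$ be its law on $\mathcal S^{\mathbb Z}$ and $E_P$ the expectation under $P$. Let $q,p_1,\dots,p_d$ be measurable maps from $\mathcal S$ to the probability measures on $\mathbb Z_+^d$. Given $\omega$, let $X_n$ and $L^{(i)}_{n,m}$ ($n\ge 0$, $1\le i\le d$, $m\ge 1$) be independent random vectors in $\mathbb Z_+^d$ such that $X_n$ has law $q(\omega_{n-1})$ and $L^{(i)}_{n,m}$ has law $p_i(\omega_n)$; write $P_\omega$ for their law given $\omega$, $E_\omega$ for the expectation under $P_\omega$, and $\mathbb P=P\otimes P_\omega$. The branching process with immigration is defined by $Z_0=\mathbf 0$ and $$Z_{n+1}=\sum_{i=1}^d\ \sum_{m=1}^{Z_n^{(i)}+X_n^{(i)}}L^{(i)}_{n,m},\qquad n\ge 0,$$ and $P_\omega(\,\cdot\mid Z_0=z)$ refers to the same recursion started from $z\in\mathbb Z_+^d$. Let $I_0=I_0(\omega)=E_\omega(X_0)$,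 and let $M_n=M_n(\omega)$ be the $d\times d$ matrix whose $i$-th column is $E_\omega(L^{(i)}_{n,1})$, all these means being taken in $[0,\infty]$. Let $\|\cdot\|_1$ be the $\ell^1$ norm of vectors and the corresponding operator norm of matrices, and $\log^+x=\max\{0,\log x\}$. Assume that (A1) $E_P(\log^+\|I_0\|_1)<\infty$; (A2) $E_P(\log^+\|M_0\|_1)<\infty$; (A3) $\lim_{n\to\infty}n^{-1}E_P(\log\|M_{n-1}\cdots M_1M_0\|_1)<0$ (expectations and limit in $[-\infty,\infty)$, with $\log 0=-\infty$). Suppose in addition that there is an integer $m\ge 1$ such that $$P\bigl(\omega: P_\omega(Z_m=\mathbf 0\mid Z_0=\mathbf 1)>0\bigr)>0,\qquad \mathbf 1=(1,\dots,1).$$ Then $\mathbb P(Z_n=\mathbf 0\text{ for infinitely many }n)=1$. If moreover $$P\bigl(\omega: P_\omega(Z_1=\mathbf 0\mid Z_0=\mathbf 1)>0\bigr)=1,$$ then the regeneration times $\nu_0=0$, $\nu_n=\inf\{i>\nu_{n-1}: Z_i=\mathbf 0\}$ (with $\inf\emptyset=\infty$) satisfy $\mathbb P(\lim_{n\to\infty}\nu_n/n=\mu)=1$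 with a finite constant $\mu=1/\pi(\mathbf 0)>0$. Here $\pi(v)=E_P\bigl(P_\omega(\tilde Z_0=v)\bigr)$ for $v\in\mathbb Z_+^d$, where $\tilde Z_0=\sum_{i<0}U_{i,0}$ and, given $\omega$ (and on an enlarged probability space), the processes $(U_{i,n})_{n\ge i}$, $i\in\mathbb Z$, are independent multitype branching processes: $U_{i,i}$ has law $q(\omega_{i-1})$, and $U_{i,n+1}$ is the sum of the offspring vectors of the particles counted by $U_{i,n}$, these vectors being independent, with law $p_j(\omega_n)$ for a particle of type $j$. -/

import Mathlib

open MeasureTheory ProbabilityTheory Filter Topology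
open scoped ENNReal

noncomputable section

namespace MBPIRE

/-! ### Products of laws that depend measurably on a parameter -/

theorem measurable_infinitePi {Ω E ι : Type*} [MeasurableSpace Ω] [MeasurableSpace E]
    (κ : ι → Kernel Ω E) [∀ i, IsMarkovKernel (κ i)] :
    Measurable fun ω => Measure.infinitePi fun i => κ i ω := by
  classical
  refine Measurable.measure_of_isPiSystem_of_isProbabilityMeasure
    (S := squareCylinders fun _ : ι => {s : Set E | MeasurableSet s}) ?_ ?_ ?_
  · exact (generateFrom_squareCylinders (α := fun _ : ι => E)).symm
  · exact isPiSystem_squareCylinders (fun _ => MeasurableSpace.isPiSystem_measurableSet)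
      (fun _ => MeasurableSet.univ)
  · rintro s hs
    obtain ⟨I, t, ht, rfl⟩ := hs
    simp only [Set.mem_pi, Set.mem_univ, Set.mem_ofPred_eq, true_implies] at ht
    have : ∀ ω, (Measure.infinitePi fun i => κ i ω) ((I : Set ι).pi t) = ∏ i ∈ I, κ i ω (t i) :=
      fun ω => Measure.infinitePi_pi _ (fun i _ => ht i)
    simp_rw [this]
    exact Finset.measurable_fun_prod _ fun i _ => (κ i).measurable_coe (ht i)

/-- Given `ω`, the coordinates are independent and the `i`-th one has law `κ i ω`. -/
def prodKernel {Ω E ι : Type*} [MeasurableSpace Ω] [MeasurableSpace E]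
    (κ : ι → Kernel Ω E) [∀ i, IsMarkovKernel (κ i)] : Kernel Ω (ι → E) where
  toFun ω := Measure.infinitePi fun i => κ i ω
  measurable' := measurable_infinitePi κ

instance {Ω E ι : Type*} [MeasurableSpace Ω] [MeasurableSpace E]
    (κ : ι → Kernel Ω E) [∀ i, IsMarkovKernel (κ i)] : IsMarkovKernel (prodKernel κ) :=
  ⟨fun ω => inferInstanceAs (IsProbabilityMeasure (Measure.infinitePi fun i => κ i ω))⟩

/-! ### The environment -/

/-- The shift on environments, `(θ ω)ₙ = ωₙ₊₁`. -/
def shift {S : Type*} (ω : ℤ → S) : ℤ → S := fun n => ω (n + 1)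

/-- A law on `ℤ₊ᵈ` that depends on the environment through its state at time `n`. -/
def lawAt {S : Type*} [MeasurableSpace S] {d : ℕ} (r : Kernel S (Fin d → ℕ)) (n : ℤ) :
    Kernel (ℤ → S) (Fin d → ℕ) :=
  r.comap (fun ω => ω n) (measurable_pi_apply n)

instance {S : Type*} [MeasurableSpace S] {d : ℕ} (r : Kernel S (Fin d → ℕ)) [IsMarkovKernel r]
    (n : ℤ) : IsMarkovKernel (lawAt r n) := by
  unfold lawAt; infer_instance

/-! ### The branching process with immigration -/

/-- Labels of the random vectors that drive the process: `inl n` for the immigration `Xₙ`, and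
`inr (n, i, m)` for the offspring `Lₙ,ₘ⁽ⁱ⁾` of the `m`-th particle of type `i` at time `n`. -/
abbrev Label (d : ℕ) : Type := ℕ ⊕ (ℕ × Fin d × ℕ)

/-- A realization of all immigration and offspring vectors. -/
abbrev Trees (d : ℕ) : Type := Label d → (Fin d → ℕ)

/-- `Xₙ` has law `q(ωₙ₋₁)` and `Lₙ,ₘ⁽ⁱ⁾` has law `pᵢ(ωₙ)`. -/
def labelLaw {S : Type*} [MeasurableSpace S] {d : ℕ} (q : Kernel S (Fin d → ℕ))
    (p : Fin d → Kernel S (Fin d → ℕ)) : Label d → Kernel (ℤ → S) (Fin d → ℕ)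
  | .inl n => lawAt q ((n : ℤ) - 1)
  | .inr (n, i, _) => lawAt (p i) n

instance {S : Type*} [MeasurableSpace S] {d : ℕ} (q : Kernel S (Fin d → ℕ))
    (p : Fin d → Kernel S (Fin d → ℕ)) [IsMarkovKernel q] [∀ i, IsMarkovKernel (p i)]
    (l : Label d) : IsMarkovKernel (labelLaw q p l) := by
  rcases l with n | ⟨n, i, m⟩ <;> (unfold labelLaw; infer_instance)

/-- The quenched law `P_ω`: in a fixed environment all `Xₙ` and `Lₙ,ₘ⁽ⁱ⁾` are independent. -/
def quenched {S : Type*} [MeasurableSpace S] {d : ℕ} (q : Kernel S (Fin d → ℕ))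
    (p : Fin d → Kernel S (Fin d → ℕ)) [IsMarkovKernel q] [∀ i, IsMarkovKernel (p i)] :
    Kernel (ℤ → S) (Trees d) :=
  prodKernel (labelLaw q p)

/-- The joint law `ℙ = P ⊗ P_ω` of the environment and the immigration and offspring vectors. -/
def annealed {S : Type*} [MeasurableSpace S] {d : ℕ} (P : Measure (ℤ → S))
    (q : Kernel S (Fin d → ℕ)) (p : Fin d → Kernel S (Fin d → ℕ))
    [IsMarkovKernel q] [∀ i, IsMarkovKernel (p i)] : Measure ((ℤ → S) × Trees d) :=
  P ⊗ₘ quenched q p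

/-- The process `Zₙ` started from `z`; each particle, immigrants included, is replaced by its
offspring: `Zₙ₊₁ = ∑ᵢ ∑_{m < Zₙ⁽ⁱ⁾ + Xₙ⁽ⁱ⁾} Lₙ,ₘ⁽ⁱ⁾`. -/
def Z {d : ℕ} (z : Fin d → ℕ) (t : Trees d) : ℕ → (Fin d → ℕ)
  | 0 => z
  | n + 1 => ∑ i, ∑ m ∈ Finset.range (Z z t n i + t (.inl n) i), t (.inr (n, i, m))

/-- The regeneration times: `ν₀ = 0` and `νₙ₊₁ = inf {i > νₙ : Zᵢ = 0}` for the process started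
from `0`, with `inf ∅ = ∞`. -/
def regenTime {d : ℕ} (t : Trees d) : ℕ → ℕ∞
  | 0 => 0
  | n + 1 => ⨅ (i : ℕ) (_ : regenTime t n < i ∧ Z 0 t i = 0), (i : ℕ∞)

/-! ### Means and the standing moment assumptions -/

/-- The `j`-th component of `Iₙ`: the quenched mean of `Xₙ⁽ʲ⁾`. -/
def immMean {S : Type*} [MeasurableSpace S] {d : ℕ} (q : Kernel S (Fin d → ℕ))
    (n : ℤ) (ω : ℤ → S) : Fin d → ℝ≥0∞ :=
  fun j => ∫⁻ v, (v j : ℝ≥0∞) ∂(lawAt q (n - 1) ω)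

/-- The matrix `Mₙ`, whose `i`-th column is the quenched mean offspring vector of a particle of
type `i` at time `n`. -/
def meanMatrix {S : Type*} [MeasurableSpace S] {d : ℕ} (p : Fin d → Kernel S (Fin d → ℕ))
    (n : ℤ) (ω : ℤ → S) : Matrix (Fin d) (Fin d) ℝ≥0∞ :=
  Matrix.of fun j i => ∫⁻ v, (v j : ℝ≥0∞) ∂(lawAt (p i) n ω)

/-- The product `Mₙ₋₁ ⋯ M₁ M₀`. -/
def meanProd {S : Type*} [MeasurableSpace S] {d : ℕ} (p : Fin d → Kernel S (Fin d → ℕ)) :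
    ℕ → (ℤ → S) → Matrix (Fin d) (Fin d) ℝ≥0∞
  | 0, _ => 1
  | n + 1, ω => meanMatrix p n ω * meanProd p n ω

/-- The `ℓ¹` norm of a vector with components in `[0, ∞]`. -/
def norm1 {d : ℕ} (v : Fin d → ℝ≥0∞) : ℝ≥0∞ := ∑ j, v j

/-- The operator norm for the `ℓ¹` norm of a matrix with entries in `[0, ∞]`. As the entries are
nonnegative, it is enough to test nonnegative vectors. -/
def opNorm1 {d : ℕ} (A : Matrix (Fin d) (Fin d) ℝ≥0∞) : ℝ≥0∞ :=
  ⨆ (v : Fin d → ℝ≥0∞) (_ : norm1 v ≤ 1), norm1 (A.mulVec v)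

/-- The operator norm for the `ℓ¹` norm is the maximal column sum. -/
theorem opNorm1_eq {d : ℕ} (A : Matrix (Fin d) (Fin d) ℝ≥0∞) :
    opNorm1 A = ⨆ i, ∑ j, A j i := by
  classical
  apply le_antisymm
  · refine iSup₂_le fun v hv => ?_
    calc norm1 (A.mulVec v) = ∑ i, (∑ j, A j i) * v i := by
          simp only [norm1, Matrix.mulVec, dotProduct, Finset.sum_mul]
          exact Finset.sum_comm
      _ ≤ ∑ i, (⨆ i, ∑ j, A j i) * v i := by
          gcongr with i _
          exact le_iSup (fun i => ∑ j, A j i) i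
      _ = (⨆ i, ∑ j, A j i) * norm1 v := by rw [norm1, Finset.mul_sum]
      _ ≤ _ := mul_le_of_le_one_right' hv
  · refine iSup_le fun i => ?_
    refine le_iSup₂_of_le (Pi.single i 1) (by simp [norm1, Finset.sum_pi_single']) ?_
    simp [norm1]

/-- The expectation in `[-∞, ∞]` of an extended real random variable, `E(f⁺) - E(f⁻)`. -/
def eexp {Ω : Type*} [MeasurableSpace Ω] (P : Measure Ω) (f : Ω → EReal) : EReal :=
  ((∫⁻ ω, (f ω).toENNReal ∂P : ℝ≥0∞) : EReal) - ((∫⁻ ω, (-f ω).toENNReal ∂P : ℝ≥0∞) : EReal)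

/-- The standing assumptions (`(log x).toENNReal` is `log⁺ x`, with `log 0 = -∞`, `log ∞ = ∞`). In
`A3` the expectation lies in `[-∞, ∞)` by `A2`. -/
structure Subcritical {S : Type*} [MeasurableSpace S] {d : ℕ} (P : Measure (ℤ → S))
    (q : Kernel S (Fin d → ℕ)) (p : Fin d → Kernel S (Fin d → ℕ)) : Prop where
  A1 : ∫⁻ ω, (ENNReal.log (norm1 (immMean q 0 ω))).toENNReal ∂P < ∞
  A2 : ∫⁻ ω, (ENNReal.log (opNorm1 (meanMatrix p 0 ω))).toENNReal ∂P < ∞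
  A3 : ∃ γ : EReal, γ < 0 ∧
    Tendsto (fun n : ℕ => eexp P (fun ω => ENNReal.log (opNorm1 (meanProd p n ω))) / (n : EReal))
      atTop (𝓝 γ)

/-! ### The stationary version and its one-dimensional law -/

/-- Labels for the family of independent lines of descent: `inl i` for the immigrants `Xᵢ`, `i ∈ ℤ`,
and `inr (i, k, j, m)` for the offspring of the `m`-th particle of type `j` among those that descend
from the immigrants of time `i` and live at time `i + k`. -/
abbrev WaveLabel (d : ℕ) : Type := ℤ ⊕ (ℤ × ℕ × Fin d × ℕ)

abbrev WaveTrees (d : ℕ) : Type := WaveLabel d → (Fin d → ℕ)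

def waveLabelLaw {S : Type*} [MeasurableSpace S] {d : ℕ} (q : Kernel S (Fin d → ℕ))
    (p : Fin d → Kernel S (Fin d → ℕ)) : WaveLabel d → Kernel (ℤ → S) (Fin d → ℕ)
  | .inl i => lawAt q (i - 1)
  | .inr (i, k, j, _) => lawAt (p j) (i + k)

instance {S : Type*} [MeasurableSpace S] {d : ℕ} (q : Kernel S (Fin d → ℕ))
    (p : Fin d → Kernel S (Fin d → ℕ)) [IsMarkovKernel q] [∀ i, IsMarkovKernel (p i)]
    (l : WaveLabel d) : IsMarkovKernel (waveLabelLaw q p l) := by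
  rcases l with i | ⟨i, k, j, m⟩ <;> (unfold waveLabelLaw; infer_instance)

/-- The quenched law of the enlarged family. -/
def waveQuenched {S : Type*} [MeasurableSpace S] {d : ℕ} (q : Kernel S (Fin d → ℕ))
    (p : Fin d → Kernel S (Fin d → ℕ)) [IsMarkovKernel q] [∀ i, IsMarkovKernel (p i)] :
    Kernel (ℤ → S) (WaveTrees d) :=
  prodKernel (waveLabelLaw q p)

/-- `U t i k` is the progeny `U_{i, i+k}`, living at time `i + k`, of the immigrants of time `i`. -/
def U {d : ℕ} (t : WaveTrees d) (i : ℤ) : ℕ → (Fin d → ℕ)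
  | 0 => t (.inl i)
  | k + 1 => ∑ j, ∑ m ∈ Finset.range (U t i k j), t (.inr (i, k, j, m))

/-- `Z̃ₙ = ∑_{i < n} U_{i,n}`, with components in `[0, ∞]`; the index is `i = n - (k + 1)`. -/
def Ztilde {d : ℕ} (t : WaveTrees d) (n : ℤ) : Fin d → ℝ≥0∞ :=
  fun j => ∑' k : ℕ, (U t (n - (k + 1)) (k + 1) j : ℝ≥0∞)

/-- `π(v) = E_P[P_ω(Z̃₀ = v)]`. -/
def stationaryProb {S : Type*} [MeasurableSpace S] {d : ℕ} (P : Measure (ℤ → S))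
    (q : Kernel S (Fin d → ℕ)) (p : Fin d → Kernel S (Fin d → ℕ))
    [IsMarkovKernel q] [∀ i, IsMarkovKernel (p i)] (v : Fin d → ℕ) : ℝ≥0∞ :=
  ∫⁻ ω, waveQuenched q p ω {t | ∀ j, Ztilde t 0 j = (v j : ℝ≥0∞)} ∂P

end MBPIRE

end

/-!
The key point is that `Zₙ`, as a function of its initial state, is monotone. Let `T` be the shift of
the environment together with the driving vectors. A zero of `Z` at time `m + n` forces a zero at
time `n` of the process restarted from `0` at time `m`, so the events `Aₙ = {Zₙ = 0}` satisfy `Aₘ₊ₙ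
⊆ T⁻ᵐ Aₙ`. Hence the number of zeros before time `n` is a subadditive process, and a bounded form of
the subadditive ergodic theorem (`tendsto_frequency_of_subset_preimage`) shows that the frequency of
zeros converges almost surely to `lim P(Aₙ)`. The map `T` is ergodic (`ergodic_jointShift`): given
the environment, an invariant event is a tail event of independent vectors, so that its quenched
probability is `0` or `1` by Kolmogorov's law, and this probability is an invariant function of the
environment.

By the composition of generating functions (`lintegral_monomial_Z`, `lintegral_monomial_U`), `P(Aₙ)`
is the probability that none of the immigrants of the times `-n, …, -1` has descendants at time `0`;
it therefore decreases to `π(0)` (`tendsto_annealed_Z_eq_zero`). So the frequency of zeros is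
`π(0)`, without any moment assumption. If `π(0) > 0`, then there are infinitely many zeros, and
inverting the counting function gives `νₙ / n → 1 / π(0)`.

The moment assumptions yield `π(0) > 0` (`stationaryProb_zero_ne_zero`). The quenched mean at time
`0` of the process started at time `-n` increases with `n`. By `A3`, some product of `N` mean
matrices contracts on average in the logarithm, so a maximal ergodic theorem and the logarithmic
moments show that these means stay bounded with positive probability
(`frequently_tsum_prod_lt_top`); as the event is invariant, they stay bounded almost surely
(`ae_iSup_pastMean_lt_top`). Markov's inequality then bounds from below, uniformly in `n`, the
probability that the population at time `0` is small, and in a suitable environment a small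
population dies out within `m` steps with positive probability.
-/

noncomputable section

namespace MBPIRE

/-! ### Ergodic theorems -/

section Ergodic

variable {X : Type*} {T : X → X} {S : ℕ → X → ℝ}

/-- The covering step of the subadditive ergodic theorem: an orbit segment is cut into blocks of
length at most `N` on which `S` grows at rate at most `c`, and steps from points where no such block
starts, which are counted by `bad`. -/
theorem subadditive_le_of_blocks
    (hsub : ∀ m n x, S (m + n) x ≤ S m x + S n (T^[m] x))
    (h1 : ∀ n x, S n x ≤ n) {c : ℝ} (hc : 0 ≤ c) {N : ℕ} {bad : X → ℝ} (hbad0 : ∀ x, 0 ≤ bad x)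
    (hbad : ∀ x, bad x = 1 ∨ ∃ n, 1 ≤ n ∧ n ≤ N ∧ S n x ≤ c * n) (K : ℕ) (x : X) :
    S K x ≤ c * K + birkhoffSum T bad K x + N := by
  induction K using Nat.strong_induction_on generalizing x with
  | _ K ih =>
    have hB : ∀ k y, 0 ≤ birkhoffSum T bad k y := fun k y =>
      Finset.sum_nonneg fun i _ => hbad0 _
    rcases le_or_gt K N with hKN | hKN
    · have : (K : ℝ) ≤ N := by exact_mod_cast hKN
      have := h1 K x
      have := hB K x
      have : 0 ≤ c * K := by positivity
      linarith
    · rcases hbad x with hx | ⟨n, hn1, hnN, hn⟩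
      · obtain ⟨k, rfl⟩ : ∃ k, K = 1 + k := ⟨K - 1, by omega⟩
        have e1 := hsub 1 k x
        have e2 := h1 1 x
        have e3 := ih k (by omega) (T^[1] x)
        rw [birkhoffSum_add, birkhoffSum_one, hx]
        push_cast at *
        linarith
      · obtain ⟨k, rfl⟩ : ∃ k, K = n + k := ⟨K - n, by omega⟩
        have e1 := hsub n k x
        have e3 := ih k (by omega) (T^[n] x)
        have := hB n x
        rw [birkhoffSum_add]
        push_cast at *
        linarith

variable [MeasurableSpace X] {μ : Measure X}

theorem integral_birkhoffSum (hT : MeasurePreserving T μ μ) {g : X → ℝ} (hg : Integrable g μ)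
    (n : ℕ) : ∫ x, birkhoffSum T g n x ∂μ = n * ∫ x, g x ∂μ := by
  have hi : ∀ k, Integrable (fun x => g (T^[k] x)) μ := fun k =>
    (hT.iterate k).integrable_comp_of_integrable hg
  simp only [birkhoffSum]
  rw [integral_finsetSum _ fun k _ => hi k]
  have : ∀ k, ∫ x, g (T^[k] x) ∂μ = ∫ x, g x ∂μ := fun k => by
    have := integral_map (μ := μ) (φ := T^[k]) (f := g) (hT.iterate k).aemeasurable
      (by rw [(hT.iterate k).map_eq]; exact hg.aestronglyMeasurable)
    rw [(hT.iterate k).map_eq] at this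
    exact this.symm
  simp [this]

theorem measurable_birkhoffSum (hT : Measurable T) {g : X → ℝ} (hg : Measurable g) (n : ℕ) :
    Measurable (birkhoffSum T g n) := by
  unfold birkhoffSum
  exact Finset.measurable_fun_sum _ fun k _ => hg.comp (hT.iterate k)

/-- The lower half of the subadditive ergodic theorem, for increments in `[0, 1]`. -/
theorem ae_eventually_le_of_subadditive [IsProbabilityMeasure μ] (hT : Ergodic T μ)
    (hS : ∀ n, Measurable (S n))
    (hsub : ∀ m n x, S (m + n) x ≤ S m x + S n (T^[m] x)) (h0 : ∀ n x, 0 ≤ S n x)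
    (h1 : ∀ n x, S n x ≤ n) {a : ℝ} (ha : ∀ n : ℕ, a * n ≤ ∫ x, S n x ∂μ) {c' : ℝ} (hca' : c' < a) :
    ∀ᵐ x ∂μ, ∀ᶠ n : ℕ in atTop, c' * n ≤ S n x := by
  obtain ⟨c, hcc', hca⟩ := exists_between hca'
  -- `C` is the event that the lower limit of `S n / n` is less than `c`.
  set C : Set X := {x | ∃ k : ℕ, ∃ᶠ n : ℕ in atTop, S n x < (c - 1 / (k + 1)) * n} with hC
  have hCm : MeasurableSet C := by
    simp only [hC, frequently_atTop]
    measurability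
  have hCinv : T ⁻¹' C ⊆ C := by
    rintro x ⟨k, hk⟩
    refine ⟨k + 1, ?_⟩
    have hε : (0 : ℝ) < 1 / (k + 1) - 1 / ((k + 1 : ℕ) + 1) := by
      rw [sub_pos]
      push_cast
      gcongr
      linarith
    set ε : ℝ := 1 / (k + 1) - 1 / ((k + 1 : ℕ) + 1) with hεdef
    set b : ℝ := c - 1 / ((k + 1 : ℕ) + 1) with hb
    obtain ⟨n₀, hn₀⟩ := exists_nat_gt ((1 - b) / ε)
    rw [frequently_atTop] at hk ⊢
    intro m
    obtain ⟨n, hn, hlt⟩ := hk (max m n₀)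
    refine ⟨1 + n, by have := le_max_left m n₀; omega, ?_⟩
    have e1 := hsub 1 n x
    have e2 := h1 1 x
    have e3 : (1 - b) / ε < n := hn₀.trans_le (by exact_mod_cast (le_max_right m n₀).trans hn)
    rw [div_lt_iff₀ hε] at e3
    have e4 : (c - 1 / (k + 1 : ℝ)) = b - ε := by rw [hb, hεdef]; ring
    rw [e4] at hlt
    simp only [Function.iterate_one] at e1
    push_cast at e2 ⊢
    nlinarith
  rcases hT.ae_empty_or_univ_of_preimage_ae_le hCm.nullMeasurableSet
    (LE.le.eventuallyLE hCinv) with h | h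
  · obtain ⟨k, hk⟩ := exists_nat_one_div_lt (sub_pos.2 hcc')
    filter_upwards [eventuallyEq_empty.1 h] with x hxC
    have hev : ∀ᶠ n : ℕ in atTop, ¬ S n x < (c - 1 / (k + 1)) * n := by
      by_contra hcon
      exact hxC ⟨k, not_eventually.1 hcon |>.mono fun n hn => not_not.1 hn⟩
    filter_upwards [hev] with n hn
    have hn0 : (0 : ℝ) ≤ n := Nat.cast_nonneg n
    nlinarith [not_lt.1 hn]
  -- Otherwise almost every orbit can be cut into blocks with growth rate at most `c`, up to a set
  -- of bad points of measure less than `a - c`, so that the means of `S K` are too small.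
  · exfalso
    have hCae : ∀ᵐ x ∂μ, ∃ n : ℕ, 1 ≤ n ∧ S n x ≤ c * n := by
      filter_upwards [eventuallyEq_univ.1 h] with x hxC
      obtain ⟨k, hk⟩ := hxC
      obtain ⟨n, hn, hlt⟩ := frequently_atTop.1 hk 1
      refine ⟨n, hn, hlt.le.trans ?_⟩
      gcongr
      simp only [sub_le_self_iff]
      positivity
    have hc : 0 ≤ c := by
      obtain ⟨x, n, hn, hx⟩ := hCae.exists
      have h2 : (0 : ℝ) < n := by exact_mod_cast hn
      exact nonneg_of_mul_nonneg_left ((h0 n x).trans hx) h2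
    set B : ℕ → Set X := fun N => {x | ∀ n, 1 ≤ n → n ≤ N → c * n < S n x} with hB
    have hBm : ∀ N, MeasurableSet (B N) := fun N => by
      simp only [hB]
      measurability
    have hB0 : μ (⋂ N, B N) = 0 := by
      refine measure_mono_null (fun x hx => ?_) (ae_iff.1 hCae)
      rintro ⟨n, hn, hle⟩
      exact absurd (Set.mem_iInter.1 hx n n hn le_rfl) (not_lt.2 hle)
    have hBt : Tendsto (fun N => μ (B N)) atTop (𝓝 0) := by
      rw [← hB0]
      exact tendsto_measure_iInter_atTop (fun N => (hBm N).nullMeasurableSet)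
        (fun N M hNM x hx n h1 h2 => hx n h1 (h2.trans hNM)) ⟨0, measure_ne_top _ _⟩
    obtain ⟨N, hN⟩ : ∃ N, μ (B N) < ENNReal.ofReal (a - c) :=
      (hBt.eventually (gt_mem_nhds (ENNReal.ofReal_pos.2 (sub_pos.2 hca)))).exists
    have hN' : μ.real (B N) < a - c := by
      rw [← ENNReal.ofReal_toReal (measure_ne_top μ (B N))] at hN
      exact (ENNReal.ofReal_lt_ofReal_iff (sub_pos.2 hca)).1 hN
    set g : X → ℝ := (B N).indicator 1 with hg
    have hgi : Integrable g μ := (integrable_const (1 : ℝ)).indicator (hBm N)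
    have hgI : ∫ x, g x ∂μ = μ.real (B N) := by
      rw [hg, integral_indicator_one (hBm N)]
    have hbd : ∀ K x, S K x ≤ c * K + birkhoffSum T g K x + N := by
      refine subadditive_le_of_blocks hsub h1 hc
        (fun x => Set.indicator_nonneg (by simp) x) fun x => ?_
      by_cases hx : x ∈ B N
      · left; simp [hg, hx]
      · right
        simp only [hB, Set.mem_ofPred_eq, not_forall, not_lt] at hx
        obtain ⟨n, hn1, hn2, hn3⟩ := hx
        exact ⟨n, hn1, hn2, hn3⟩
    have hSi : ∀ n, Integrable (S n) μ := fun n =>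
      Integrable.of_bound (hS n).aestronglyMeasurable n
        (ae_of_all _ fun x => by rw [Real.norm_eq_abs, abs_of_nonneg (h0 n x)]; exact h1 n x)
    have hbi : ∀ n, Integrable (birkhoffSum T g n) μ := fun n => by
      unfold birkhoffSum
      exact integrable_finsetSum _ fun k _ =>
        (hT.toMeasurePreserving.iterate k).integrable_comp_of_integrable hgi
    have hint : ∀ K : ℕ, a * K ≤ c * K + K * μ.real (B N) + N := fun K => by
      have h2 : Integrable (fun x => c * K + birkhoffSum T g K x) μ :=
        (integrable_const (c * (K : ℝ))).add (hbi K)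
      have h3 : Integrable (fun x => c * K + birkhoffSum T g K x + N) μ :=
        h2.add (integrable_const (N : ℝ))
      calc a * K ≤ ∫ x, S K x ∂μ := ha K
        _ ≤ ∫ x, c * K + birkhoffSum T g K x + N ∂μ := integral_mono (hSi K) h3 (hbd K)
        _ = c * K + K * μ.real (B N) + N := by
          rw [integral_add h2 (integrable_const _), integral_add (integrable_const _) (hbi K),
            integral_birkhoffSum hT.toMeasurePreserving hgi, hgI]
          simp
    obtain ⟨K, hK⟩ := exists_nat_gt ((N : ℝ) / (a - c - μ.real (B N)))
    rw [div_lt_iff₀ (by linarith)] at hK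
    nlinarith [hint K]

/-- If `T^m` maps `A (m + n)` into `A n`, then the frequency of the visits of the moving sets `A k`
is the limit of the (decreasing) probabilities of the `A k`. -/
theorem tendsto_frequency_of_subset_preimage [IsProbabilityMeasure μ] (hT : Ergodic T μ)
    {A : ℕ → Set X} (hA : ∀ n, MeasurableSet (A n))
    (hsub : ∀ m n, A (m + n) ⊆ T^[m] ⁻¹' A n) {a : ℝ}
    (ha : Tendsto (fun n => μ.real (A n)) atTop (𝓝 a)) :
    ∀ᵐ x ∂μ, Tendsto (fun n : ℕ => (∑ k ∈ Finset.range n, (A k).indicator 1 x) / (n : ℝ))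
      atTop (𝓝 a) := by
  set S : ℕ → X → ℝ := fun n x => ∑ k ∈ Finset.range n, (A k).indicator 1 x with hS
  have hind : ∀ (B : Set X) x, 0 ≤ B.indicator (1 : X → ℝ) x ∧ B.indicator (1 : X → ℝ) x ≤ 1 :=
    fun B x => ⟨Set.indicator_nonneg (by simp) x, by
      by_cases hx : x ∈ B <;> simp [hx]⟩
  have hle : ∀ m n x, (A (m + n)).indicator (1 : X → ℝ) x ≤ (A n).indicator 1 (T^[m] x) := by
    intro m n x
    by_cases hx : x ∈ A (m + n)
    · have : T^[m] x ∈ A n := hsub m n hx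
      simp [hx, this]
    · rw [Set.indicator_of_notMem hx]; exact (hind _ _).1
  have hanti : Antitone fun n => μ.real (A n) := by
    refine antitone_nat_of_succ_le fun n => ?_
    rw [add_comm]
    calc μ.real (A (1 + n)) ≤ μ.real (T^[1] ⁻¹' A n) := measureReal_mono (hsub 1 n)
      _ = μ.real (A n) := by
        rw [measureReal_def, (hT.toMeasurePreserving.iterate 1).measure_preimage
          (hA n).nullMeasurableSet, measureReal_def]
  have hlow : ∀ c < a, ∀ᵐ x ∂μ, ∀ᶠ n : ℕ in atTop, c * n ≤ S n x := fun c hc => by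
    refine ae_eventually_le_of_subadditive hT (S := S) (fun n => ?_) (fun m n x => ?_)
      (fun n x => Finset.sum_nonneg fun k _ => (hind _ _).1) (fun n x => ?_) (fun n => ?_) hc
    · exact Finset.measurable_fun_sum _ fun k _ => measurable_one.indicator (hA k)
    · simp only [hS]
      rw [Finset.sum_range_add]
      gcongr with k _
      exact hle m k x
    · calc S n x ≤ ∑ k ∈ Finset.range n, (1 : ℝ) := Finset.sum_le_sum fun k _ => (hind _ _).2
        _ = n := by simp
    · simp only [hS]
      have hi : ∀ k, Integrable ((A k).indicator (1 : X → ℝ)) μ := fun k =>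
        (integrable_const (1 : ℝ)).indicator (hA k)
      rw [integral_finsetSum _ fun k _ => hi k]
      simp only [integral_indicator_one (hA _)]
      calc a * n = ∑ k ∈ Finset.range n, a := by simp [mul_comm]
        _ ≤ _ := Finset.sum_le_sum fun k _ => hanti.le_of_tendsto ha k
  -- For fixed `m` the ergodic averages of the indicator of `A m` bound the frequency from above.
  -- The lower bound, applied to the additive process of the complement, controls these averages.
  have hup : ∀ c > a, ∀ᵐ x ∂μ, ∀ᶠ n : ℕ in atTop, S n x ≤ c * n := fun c hc => by
    obtain ⟨b, hab, hbc⟩ := exists_between hc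
    obtain ⟨m, hm⟩ := (ha.eventually (gt_mem_nhds hab)).exists
    set g : X → ℝ := (A m)ᶜ.indicator 1 with hg
    have hgi : Integrable g μ := (integrable_const (1 : ℝ)).indicator (hA m).compl
    have hgI : ∫ x, g x ∂μ = 1 - μ.real (A m) := by
      rw [hg, integral_indicator_one (hA m).compl, probReal_compl_eq_one_sub (hA m)]
    have key := ae_eventually_le_of_subadditive hT (S := fun n => birkhoffSum T g n)
      (fun n => measurable_birkhoffSum hT.measurable (measurable_one.indicator (hA m).compl) n)
      (fun m n x => (birkhoffSum_add T g m n x).le)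
      (fun n x => Finset.sum_nonneg fun k _ => (hind _ _).1)
      (fun n x => by
        calc birkhoffSum T g n x ≤ ∑ k ∈ Finset.range n, (1 : ℝ) :=
              Finset.sum_le_sum fun k _ => (hind _ _).2
          _ = n := by simp)
      (a := 1 - μ.real (A m))
      (fun n => by rw [integral_birkhoffSum hT.toMeasurePreserving hgi, hgI, mul_comm])
      (c' := 1 - b) (by linarith)
    filter_upwards [key] with x hx
    obtain ⟨n₀, hn₀⟩ := exists_nat_gt ((m : ℝ) / (c - b))
    filter_upwards [hx, eventually_ge_atTop n₀] with n hn hnn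
    rw [div_lt_iff₀ (by linarith)] at hn₀
    have h1 : S n x ≤ m + ∑ k ∈ Finset.range n, (A m).indicator (1 : X → ℝ) (T^[k] x) := by
      have hmono : S n x ≤ S (m + n) x := by
        simp only [hS]
        rw [add_comm m n, Finset.sum_range_add]
        exact le_add_of_nonneg_right (Finset.sum_nonneg fun k _ => (hind _ _).1)
      refine hmono.trans ?_
      simp only [hS]
      rw [Finset.sum_range_add]
      gcongr with k _
      · calc _ ≤ ∑ k ∈ Finset.range m, (1 : ℝ) := Finset.sum_le_sum fun k _ => (hind _ _).2
          _ = m := by simp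
      · rw [add_comm m k]; exact hle k m x
    have h2 : ∑ k ∈ Finset.range n, (A m).indicator (1 : X → ℝ) (T^[k] x)
        = n - birkhoffSum T g n x := by
      have : ∀ y, (A m).indicator (1 : X → ℝ) y = 1 - g y := fun y => by
        by_cases hy : y ∈ A m <;> simp [hg, hy]
      simp [this, birkhoffSum]
    have h3 : (n₀ : ℝ) ≤ n := by exact_mod_cast hnn
    have h4 : (n₀ : ℝ) * (c - b) ≤ n * (c - b) :=
      mul_le_mul_of_nonneg_right h3 (by linarith)
    linarith
  have hall : ∀ᵐ x ∂μ, ∀ j : ℕ, ∀ᶠ n : ℕ in atTop,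
      (a - 1 / (j + 1)) * n ≤ S n x ∧ S n x ≤ (a + 1 / (j + 1)) * n := by
    refine ae_all_iff.2 fun j => ?_
    have hj : (0 : ℝ) < 1 / (j + 1) := by positivity
    filter_upwards [hlow (a - 1 / (j + 1)) (by linarith), hup (a + 1 / (j + 1)) (by linarith)]
      with x h1 h2 using h1.and h2
  filter_upwards [hall] with x hx
  rw [Metric.tendsto_atTop']
  intro ε hε
  obtain ⟨j, hj⟩ := exists_nat_one_div_lt hε
  obtain ⟨N, hN⟩ := eventually_atTop.1 (hx j)
  refine ⟨N, fun n hn => ?_⟩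
  obtain ⟨h1, h2⟩ := hN n hn.le
  have hn0 : (0 : ℝ) < n := by exact_mod_cast (by omega : 0 < n)
  rw [Real.dist_eq, abs_lt]
  constructor
  · rw [neg_lt_sub_iff_lt_add, ← sub_lt_iff_lt_add', lt_div_iff₀ hn0]
    nlinarith
  · rw [sub_lt_iff_lt_add', div_lt_iff₀ hn0]
    nlinarith

/-- A consequence of the maximal ergodic theorem: if `g` has negative mean, then all its Birkhoff
sums are nonpositive with positive probability. -/
theorem frequently_birkhoffSum_nonpos [IsProbabilityMeasure μ] (hT : MeasurePreserving T μ μ)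
    {g : X → ℝ} (hgm : Measurable g) (hg : Integrable g μ) (hneg : ∫ x, g x ∂μ < 0) :
    ∃ᵐ x ∂μ, ∀ n, birkhoffSum T g n x ≤ 0 := by
  intro hcon
  have hcon' : ∀ᵐ x ∂μ, ∃ n, 0 < birkhoffSum T g n x := by
    filter_upwards [hcon] with x hx
    simpa using hx
  -- `M n` is the maximum of the first `n + 1` Birkhoff sums.
  obtain ⟨M, hM0, hMs⟩ : ∃ M : ℕ → X → ℝ, (∀ x, M 0 x = 0) ∧
      ∀ n x, M (n + 1) x = max 0 (g x + M n (T x)) :=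
    ⟨fun n => Nat.rec (fun _ => 0) (fun _ f x => max 0 (g x + f (T x))) n,
      fun _ => rfl, fun _ _ => rfl⟩
  have hMnn : ∀ n x, 0 ≤ M n x := fun n x => by
    cases n with
    | zero => exact (hM0 x).ge
    | succ n => rw [hMs]; exact le_max_left _ _
  have hMmono : ∀ n x, M n x ≤ M (n + 1) x := fun n => by
    induction n with
    | zero => exact fun x => by rw [hM0]; exact hMnn _ _
    | succ n ih =>
      intro x
      rw [hMs, hMs (n + 1)]
      gcongr
      exact ih (T x)
  have hMi : ∀ n, Integrable (M n) μ := fun n => by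
    induction n with
    | zero => rw [funext hM0]; exact integrable_zero _ _ _
    | succ n ih =>
      rw [funext (hMs n)]
      have h1 : Integrable (fun x => g x + M n (T x)) μ :=
        hg.add (hT.integrable_comp_of_integrable ih)
      exact (integrable_zero X ℝ μ).sup h1
  have hMm : ∀ n, Measurable (M n) := fun n => by
    induction n with
    | zero => rw [funext hM0]; exact measurable_const
    | succ n ih =>
      rw [funext (hMs n)]
      exact measurable_const.max (hgm.add (ih.comp hT.measurable))
  have hMle : ∀ n k, k ≤ n → ∀ x, birkhoffSum T g k x ≤ M n x := fun n => by
    induction n with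
    | zero =>
      intro k hk x
      obtain rfl : k = 0 := by omega
      simp [hM0]
    | succ n ih =>
      intro k hk x
      rcases k with _ | k
      · simpa using hMnn _ _
      · rw [birkhoffSum_succ', hMs]
        exact le_max_of_le_right (by gcongr; exact ih k (by omega) (T x))
  set A : ℕ → Set X := fun n => {x | 0 < M (n + 1) x} with hA
  have hAm : ∀ n, MeasurableSet (A n) := fun n => measurableSet_lt measurable_const (hMm _)
  have hpos : ∀ n, 0 ≤ ∫ x, (A n).indicator g x ∂μ := fun n => by
    have hcomp : Integrable (fun x => M n (T x)) μ := hT.integrable_comp_of_integrable (hMi n)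
    have h1 : ∫ x, M n (T x) ∂μ = ∫ x, M n x ∂μ := by
      have := integral_map (μ := μ) hT.aemeasurable (f := M n)
        (by rw [hT.map_eq]; exact (hMi n).aestronglyMeasurable)
      rw [hT.map_eq] at this
      exact this.symm
    calc 0 ≤ ∫ x, M (n + 1) x ∂μ - ∫ x, M n (T x) ∂μ := by
          rw [h1, sub_nonneg]
          exact integral_mono (hMi n) (hMi _) (hMmono n)
      _ = ∫ x, M (n + 1) x - M n (T x) ∂μ := (integral_sub (hMi _) hcomp).symm
      _ ≤ _ := by
          refine integral_mono ((hMi _).sub hcomp) (hg.indicator (hAm n)) fun x => ?_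
          by_cases hx : x ∈ A n
          · have hx' : 0 < M (n + 1) x := hx
            rw [Set.indicator_of_mem hx]
            rw [hMs] at hx' ⊢
            have : 0 < g x + M n (T x) := by simpa using hx'
            simp [max_eq_right this.le]
          · have hx' : M (n + 1) x = 0 := le_antisymm (not_lt.1 hx) (hMnn _ _)
            rw [Set.indicator_of_notMem hx]
            simp only [hx', zero_sub, Left.neg_nonpos_iff]
            exact hMnn _ _
  have hlim : Tendsto (fun n => ∫ x, (A n).indicator g x ∂μ) atTop (𝓝 (∫ x, g x ∂μ)) := by
    refine tendsto_integral_of_dominated_convergence (fun x => ‖g x‖)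
      (fun n => (hg.indicator (hAm n)).aestronglyMeasurable) hg.norm
      (fun n => ae_of_all _ fun x => norm_indicator_le_norm_self _ _) ?_
    filter_upwards [hcon'] with x hx
    obtain ⟨k, hk⟩ := hx
    refine tendsto_const_nhds.congr' ?_
    filter_upwards [eventually_ge_atTop k] with n hn
    rw [Set.indicator_of_mem]
    exact hk.trans_le (hMle (n + 1) k (by omega) x)
  exact absurd (ge_of_tendsto' hlim hpos) (not_le.2 hneg)

/-- An integrable function grows sublinearly along almost every orbit. -/
theorem ae_eventually_le_mul_of_lintegral_lt_top (hT : MeasurePreserving T μ μ)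
    [IsProbabilityMeasure μ] {h : X → ℝ≥0∞} (hm : Measurable h) (hi : ∫⁻ x, h x ∂μ < ∞)
    {ε : ℝ≥0∞} (hε : ε ≠ 0) (hε' : ε ≠ ∞) :
    ∀ᵐ x ∂μ, ∀ᶠ n : ℕ in atTop, h (T^[n] x) ≤ ε * n := by
  have hms : ∀ n : ℕ, MeasurableSet {x | ε * n < h x} := fun n =>
    measurableSet_lt measurable_const hm
  have hpt : ∀ y : ℝ≥0∞, ∑' n : ℕ, (if ε * n < y then (1 : ℝ≥0∞) else 0) ≤ y / ε + 1 := by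
    intro y
    rcases eq_or_ne y ∞ with rfl | hy
    · rw [ENNReal.top_div_of_ne_top hε']; simp
    · have hq : y / ε ≠ ∞ := ENNReal.div_ne_top hy hε
      have hlt : ∀ n : ℕ, ε * n < y → n < ⌈(y / ε).toReal⌉₊ := fun n hn => by
        rw [Nat.lt_ceil, ← ENNReal.ofReal_lt_ofReal_iff_of_nonneg (Nat.cast_nonneg n),
          ENNReal.ofReal_toReal hq, ENNReal.ofReal_natCast]
        rwa [ENNReal.lt_div_iff_mul_lt (Or.inl hε) (Or.inl hε'), mul_comm]
      rw [tsum_eq_sum (s := Finset.range ⌈(y / ε).toReal⌉₊) fun n hn => by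
        rw [if_neg]
        exact fun hn' => hn (Finset.mem_range.2 (hlt n hn'))]
      calc _ ≤ ∑ n ∈ Finset.range ⌈(y / ε).toReal⌉₊, (1 : ℝ≥0∞) :=
            Finset.sum_le_sum fun n _ => by split_ifs <;> simp
        _ = ENNReal.ofReal (⌈(y / ε).toReal⌉₊ : ℝ) := by simp
        _ ≤ ENNReal.ofReal ((y / ε).toReal + 1) :=
            ENNReal.ofReal_le_ofReal (Nat.ceil_lt_add_one ENNReal.toReal_nonneg).le
        _ = y / ε + 1 := by
            rw [ENNReal.ofReal_add ENNReal.toReal_nonneg zero_le_one, ENNReal.ofReal_toReal hq,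
              ENNReal.ofReal_one]
  have hsum : ∑' n : ℕ, μ (T^[n] ⁻¹' {x | ε * n < h x}) ≠ ∞ := by
    have e : ∀ n : ℕ, μ (T^[n] ⁻¹' {x | ε * n < h x})
        = ∫⁻ x, (if ε * n < h x then 1 else 0) ∂μ := fun n => by
      rw [(hT.iterate n).measure_preimage (hms n).nullMeasurableSet,
        ← lintegral_indicator_one (hms n)]
      refine lintegral_congr fun x => ?_
      simp [Set.indicator_apply]
    simp_rw [e]
    rw [← lintegral_tsum fun n => (Measurable.ite (hms n) measurable_const
      measurable_const).aemeasurable]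
    refine ne_of_lt ((lintegral_mono fun x => hpt (h x)).trans_lt ?_)
    rw [lintegral_add_right _ measurable_const]
    simp only [div_eq_mul_inv]
    rw [lintegral_mul_const _ hm]
    simp only [lintegral_const, measure_univ, mul_one]
    exact ENNReal.add_lt_top.2 ⟨ENNReal.mul_lt_top hi (ENNReal.inv_lt_top.2
      (pos_iff_ne_zero.2 hε)), ENNReal.one_lt_top⟩
  filter_upwards [ae_eventually_notMem hsum] with x hx
  filter_upwards [hx] with n hn
  exact not_lt.1 hn

/-- A random variable whose logarithm has negative mean is dominated by the exponential of an
integrable one with negative mean: the logarithm is truncated from below. -/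
theorem exists_log_majorant [IsProbabilityMeasure μ] {b : X → ℝ≥0∞} (hbm : Measurable b)
    (hb1 : ∫⁻ x, (ENNReal.log (b x)).toENNReal ∂μ < ∞)
    (hb2 : eexp μ (fun x => ENNReal.log (b x)) < 0) :
    ∃ g : X → ℝ, Measurable g ∧ Integrable g μ ∧ ∫ x, g x ∂μ < 0 ∧
      ∀ᵐ x ∂μ, b x ≤ ENNReal.ofReal (Real.exp (g x)) := by
  set fp : X → ℝ≥0∞ := fun x => (ENNReal.log (b x)).toENNReal with hfp
  set fm : X → ℝ≥0∞ := fun x => (-ENNReal.log (b x)).toENNReal with hfm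
  have hfpm : Measurable fp := hbm.ennreal_log.ereal_toENNReal
  have hfmm : Measurable fm := hbm.ennreal_log.neg.ereal_toENNReal
  have hlt : ∫⁻ x, fp x ∂μ < ∫⁻ x, fm x ∂μ := by
    by_contra hcon
    refine absurd hb2 (not_lt.2 ?_)
    have hle := not_lt.1 hcon
    unfold eexp
    rw [EReal.sub_nonneg (by simpa using Or.inl hb1.ne) (by simp)]
    exact_mod_cast hle
  obtain ⟨c, hc⟩ : ∃ c : ℕ, ∫⁻ x, fp x ∂μ < ∫⁻ x, min (fm x) c ∂μ := by
    have h1 : ∫⁻ x, fm x ∂μ = ⨆ c : ℕ, ∫⁻ x, min (fm x) c ∂μ := by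
      rw [← lintegral_iSup (fun c => hfmm.min measurable_const)
        (fun c c' hcc x => min_le_min_left _ (by exact_mod_cast hcc))]
      refine lintegral_congr fun x => ?_
      rw [← inf_iSup_eq, ENNReal.iSup_natCast, inf_top_eq]
    rw [h1] at hlt
    exact lt_iSup_iff.1 hlt
  have hcfin : ∫⁻ x, min (fm x) c ∂μ ≠ ∞ := by
    refine ne_of_lt ((lintegral_mono fun x => min_le_right _ _).trans_lt ?_)
    simp
  have hgm : Measurable fun x => min (fm x) (c : ℝ≥0∞) := hfmm.min measurable_const
  refine ⟨fun x => (fp x).toReal - (min (fm x) c).toReal,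
    hfpm.ennreal_toReal.sub hgm.ennreal_toReal,
    (integrable_toReal_of_lintegral_ne_top hfpm.aemeasurable hb1.ne).sub
      (integrable_toReal_of_lintegral_ne_top hgm.aemeasurable hcfin), ?_, ?_⟩
  · rw [integral_sub (integrable_toReal_of_lintegral_ne_top hfpm.aemeasurable hb1.ne)
      (integrable_toReal_of_lintegral_ne_top hgm.aemeasurable hcfin),
      integral_toReal hfpm.aemeasurable (ae_lt_top hfpm hb1.ne),
      integral_toReal hgm.aemeasurable (ae_lt_top hgm hcfin), sub_neg]
    exact (ENNReal.toReal_lt_toReal hb1.ne hcfin).2 hc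
  · filter_upwards [ae_lt_top hfpm hb1.ne] with x hx
    have hbtop : b x ≠ ∞ := fun h => by simp [hfp, h] at hx
    rcases eq_or_ne (b x) 0 with h0 | h0
    · simp [h0]
    · obtain ⟨r, hr, hbr⟩ : ∃ r : ℝ, 0 < r ∧ b x = ENNReal.ofReal r :=
        ⟨(b x).toReal, ENNReal.toReal_pos h0 hbtop, (ENNReal.ofReal_toReal hbtop).symm⟩
      have e1 : fp x = ENNReal.ofReal (Real.log r) := by
        simp only [hfp, hbr, ENNReal.log_ofReal_of_pos hr, EReal.real_coe_toENNReal]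
      have e2 : fm x = ENNReal.ofReal (-Real.log r) := by
        simp only [hfm, hbr, ENNReal.log_ofReal_of_pos hr]
        rw [← EReal.coe_neg, EReal.real_coe_toENNReal]
      rw [hbr, e1, e2]
      refine ENNReal.ofReal_le_ofReal ?_
      rw [← Real.log_le_iff_le_exp hr]
      have e3 : (min (ENNReal.ofReal (-Real.log r)) (c : ℝ≥0∞)).toReal
          ≤ max (-Real.log r) 0 := by
        rw [← ENNReal.toReal_ofReal']
        exact ENNReal.toReal_mono ENNReal.ofReal_ne_top (min_le_left _ _)
      rw [ENNReal.toReal_ofReal']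
      rcases le_total 0 (Real.log r) with h | h
      · rw [max_eq_left h]; rw [max_eq_right (by linarith)] at e3; linarith
      · rw [max_eq_right h]; rw [max_eq_left (by linarith)] at e3; linarith

/-- A random affine recursion that contracts on average converges with positive probability. -/
theorem frequently_tsum_prod_lt_top [IsProbabilityMeasure μ] (hT : MeasurePreserving T μ μ)
    {b J : X → ℝ≥0∞} (hbm : Measurable b) (hJm : Measurable J)
    (hJ : ∫⁻ x, (ENNReal.log (J x)).toENNReal ∂μ < ∞)
    (hb1 : ∫⁻ x, (ENNReal.log (b x)).toENNReal ∂μ < ∞)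
    (hb2 : eexp μ (fun x => ENNReal.log (b x)) < 0) :
    ∃ᵐ x ∂μ, ∑' j : ℕ, (∏ l ∈ Finset.range j, b (T^[l] x)) * J (T^[j] x) < ∞ := by
  obtain ⟨g, hgm, hgi, hg0, hbg⟩ := exists_log_majorant hbm hb1 hb2
  -- The products decay at rate `2δ`, and `J` grows at a rate of at most `δ`.
  obtain ⟨δ, hδ, hδg⟩ : ∃ δ : ℝ, 0 < δ ∧ ∫ x, g x ∂μ + 2 * δ < 0 :=
    ⟨-(∫ x, g x ∂μ) / 4, by linarith, by linarith⟩
  have hmax := frequently_birkhoffSum_nonpos hT (hgm.add_const (2 * δ))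
    (hgi.add (integrable_const _)) (by
      rw [integral_add hgi (integrable_const _)]; simpa using hδg)
  have hbg' : ∀ᵐ x ∂μ, ∀ l : ℕ, b (T^[l] x) ≤ ENNReal.ofReal (Real.exp (g (T^[l] x))) :=
    ae_all_iff.2 fun l => (hT.iterate l).quasiMeasurePreserving.ae hbg
  have hJlog : Measurable fun x => (ENNReal.log (J x)).toENNReal :=
    hJm.ennreal_log.ereal_toENNReal
  have hJfin : ∀ᵐ x ∂μ, ∀ l : ℕ, J (T^[l] x) < ∞ := by
    refine ae_all_iff.2 fun l => (hT.iterate l).quasiMeasurePreserving.ae (p := fun x => J x < ∞) ?_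
    filter_upwards [ae_lt_top hJlog hJ.ne] with x hx
    refine lt_top_iff_ne_top.2 fun h => ?_
    simp [h] at hx
  have hJgr := ae_eventually_le_mul_of_lintegral_lt_top hT hJlog hJ (ε := ENNReal.ofReal δ)
    (by simpa using hδ) ENNReal.ofReal_ne_top
  refine (hmax.and_eventually (hbg'.and (hJfin.and hJgr))).mono ?_
  rintro x ⟨hx1, hx2, hx3, hx4⟩
  have hprod : ∀ j, ∏ l ∈ Finset.range j, b (T^[l] x)
      ≤ ENNReal.ofReal (Real.exp (-(2 * δ * j))) := fun j => by
    calc _ ≤ ∏ l ∈ Finset.range j, ENNReal.ofReal (Real.exp (g (T^[l] x))) :=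
          Finset.prod_le_prod' fun l _ => hx2 l
      _ = ENNReal.ofReal (Real.exp (birkhoffSum T g j x)) := by
          rw [← ENNReal.ofReal_prod_of_nonneg fun l _ => (Real.exp_pos _).le, ← Real.exp_sum]
          rfl
      _ ≤ _ := by
          refine ENNReal.ofReal_le_ofReal (Real.exp_le_exp.2 ?_)
          have := hx1 j
          simp only [birkhoffSum, Finset.sum_add_distrib, Finset.sum_const, Finset.card_range,
            nsmul_eq_mul] at this ⊢
          linarith
  set f : ℕ → ℝ≥0∞ := fun j => (∏ l ∈ Finset.range j, b (T^[l] x)) * J (T^[j] x) with hf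
  have hfin : ∀ j, f j ≠ ∞ := fun j =>
    ENNReal.mul_ne_top ((hprod j).trans_lt ENNReal.ofReal_lt_top).ne (hx3 j).ne
  have hbd : ∀ᶠ j in atTop, ‖(f j).toReal‖ ≤ Real.exp (-δ) ^ j := by
    filter_upwards [hx4] with j hj
    have hJle : J (T^[j] x) ≤ ENNReal.ofReal (Real.exp (δ * j)) := by
      rcases eq_or_ne (J (T^[j] x)) 0 with h0 | h0
      · simp [h0]
      · have hr := ENNReal.toReal_pos h0 (hx3 j).ne
        rw [← ENNReal.ofReal_toReal (hx3 j).ne, ENNReal.log_ofReal_of_pos hr,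
          EReal.real_coe_toENNReal, ← ENNReal.ofReal_natCast, ← ENNReal.ofReal_mul hδ.le,
          ENNReal.ofReal_le_ofReal_iff (by positivity)] at hj
        rw [← ENNReal.ofReal_toReal (hx3 j).ne]
        exact ENNReal.ofReal_le_ofReal ((Real.log_le_iff_le_exp hr).1 hj)
    rw [Real.norm_eq_abs, abs_of_nonneg ENNReal.toReal_nonneg, ← Real.exp_nat_mul]
    refine ENNReal.toReal_le_of_le_ofReal (Real.exp_pos _).le ?_
    calc f j ≤ ENNReal.ofReal (Real.exp (-(2 * δ * j))) * ENNReal.ofReal (Real.exp (δ * j)) :=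
          mul_le_mul' (hprod j) hJle
      _ = _ := by
          rw [← ENNReal.ofReal_mul (Real.exp_pos _).le, ← Real.exp_add]
          ring_nf
  have hsum : Summable fun j => (f j).toReal :=
    Summable.of_norm_bounded_eventually_nat
      (summable_geometric_of_lt_one (Real.exp_pos _).le (by simpa using hδ)) hbd
  have : ∑' j, f j = ENNReal.ofReal (∑' j, (f j).toReal) := by
    rw [ENNReal.ofReal_tsum_of_nonneg (fun _ => ENNReal.toReal_nonneg) hsum]
    exact tsum_congr fun j => (ENNReal.ofReal_toReal (hfin j)).symm
  rw [this]
  exact ENNReal.ofReal_lt_top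

end Ergodic

/-! ### Frequency of zeros and regeneration times -/

section Count

variable {p : ℕ → Prop} [DecidablePred p]

theorem frequently_of_tendsto_count {a : ℝ} (ha : 0 < a)
    (h : Tendsto (fun n : ℕ => (Nat.count p n : ℝ) / n) atTop (𝓝 a)) : ∃ᶠ n in atTop, p n := by
  intro hcon
  obtain ⟨N, hN⟩ := eventually_atTop.1 hcon
  have hle : ∀ n, Nat.count p n ≤ N := fun n => by
    rw [Nat.count_eq_card_filter_range]
    calc _ ≤ (Finset.range N).card := Finset.card_le_card fun k hk => by
          rw [Finset.mem_filter] at hk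
          exact Finset.mem_range.2 (not_le.1 fun hkN => hN k hkN hk.2)
      _ = N := by simp
  have h0 : Tendsto (fun n : ℕ => (Nat.count p n : ℝ) / n) atTop (𝓝 0) := by
    refine squeeze_zero (fun n => by positivity) (fun n => ?_)
      (tendsto_const_div_atTop_nhds_zero_nat (N : ℝ))
    gcongr
    exact hle n
  exact ha.ne (tendsto_nhds_unique h0 h)

theorem tendsto_nth_div {a : ℝ} (ha : 0 < a)
    (h : Tendsto (fun n : ℕ => (Nat.count p n : ℝ) / n) atTop (𝓝 a)) :
    Tendsto (fun n : ℕ => (Nat.nth p n : ℝ) / n) atTop (𝓝 (1 / a)) := by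
  have hinf : (Set.ofPred p).Infinite :=
    Nat.frequently_atTop_iff_infinite.1 (frequently_of_tendsto_count ha h)
  have h1 := h.comp (Nat.nth_strictMono hinf).tendsto_atTop
  have h2 := h1.inv₀ ha.ne'
  rw [one_div]
  refine h2.congr fun n => ?_
  simp [Nat.count_nth_of_infinite hinf]

end Count

theorem regenTime_eq_nth {d : ℕ} {t : Trees d} (hinf : (Set.ofPred fun n => Z 0 t n = 0).Infinite)
    (n : ℕ) : regenTime t n = (Nat.nth (fun k => Z 0 t k = 0) n : ℕ∞) := by
  induction n with
  | zero =>
    have : Nat.nth (fun k => Z 0 t k = 0) 0 = 0 := Nat.nth_zero_of_zero rfl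
    simp [regenTime, this]
  | succ n ih =>
    simp only [regenTime]
    rw [ih]
    apply le_antisymm
    · refine iInf₂_le _ ⟨?_, Nat.nth_mem_of_infinite hinf (n + 1)⟩
      exact_mod_cast Nat.nth_strictMono hinf n.lt_succ_self
    · refine le_iInf₂ fun i hi => ?_
      have h1 : Nat.nth (fun k => Z 0 t k = 0) n < i := by exact_mod_cast hi.1
      have h2 : Nat.nth (fun k => Z 0 t k = 0) (n + 1) ≤ i := by
        by_contra hcon
        exact absurd (Nat.le_nth_of_lt_nth_succ (not_le.1 hcon) hi.2) (not_le.2 h1)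
      exact_mod_cast h2

theorem tendsto_regenTime_div {d : ℕ} {t : Trees d} {a : ℝ} (ha : 0 < a)
    (h : Tendsto (fun n : ℕ => (Nat.count (fun k => Z 0 t k = 0) n : ℝ) / n) atTop (𝓝 a)) :
    Tendsto (fun n : ℕ => (regenTime t n : ℝ≥0∞) / (n : ℝ≥0∞)) atTop
      (𝓝 (ENNReal.ofReal (1 / a))) := by
  have hinf := Nat.frequently_atTop_iff_infinite.1 (frequently_of_tendsto_count ha h)
  refine (ENNReal.tendsto_ofReal (tendsto_nth_div ha h)).congr' ?_
  filter_upwards [eventually_gt_atTop 0] with n hn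
  rw [regenTime_eq_nth hinf, ENNReal.ofReal_div_of_pos (by exact_mod_cast hn)]
  simp

/-! ### Functions of disjoint families of coordinates -/

section Product

variable {ι E : Type*} [MeasurableSpace E] (ν : ι → Measure E) [∀ l, IsProbabilityMeasure (ν l)]

theorem indep_cylinderEvents {Δ Δ' : Set ι} (h : Disjoint Δ Δ') :
    Indep (cylinderEvents (X := fun _ : ι => E) Δ) (cylinderEvents Δ')
      (Measure.infinitePi ν) :=
  indep_iSup_of_disjoint (fun i => (measurable_pi_apply i).comap_le)
    (iIndepFun_infinitePi (P := ν) (X := fun _ x => x) fun _ => measurable_id) h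

theorem lintegral_mul_of_disjoint {Δ Δ' : Set ι} (h : Disjoint Δ Δ') {f g : (ι → E) → ℝ≥0∞}
    (hf : Measurable[cylinderEvents (X := fun _ : ι => E) Δ] f)
    (hg : Measurable[cylinderEvents (X := fun _ : ι => E) Δ'] g) :
    ∫⁻ t, f t * g t ∂Measure.infinitePi ν
      = (∫⁻ t, f t ∂Measure.infinitePi ν) * ∫⁻ t, g t ∂Measure.infinitePi ν :=
  lintegral_mul_eq_lintegral_mul_lintegral_of_independent_measurableSpace
    cylinderEvents_le_pi cylinderEvents_le_pi (indep_cylinderEvents ν h) hf hg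

/-- A discrete random variable can be frozen when integrating a function of it and of independent
coordinates. -/
theorem lintegral_freeze {Δ Δ' : Set ι} (h : Disjoint Δ Δ') {F : Type*} [Countable F]
    [MeasurableSpace F] [MeasurableSingletonClass F] {Y : (ι → E) → F}
    (hY : Measurable[cylinderEvents (X := fun _ : ι => E) Δ] Y) {G : F → (ι → E) → ℝ≥0∞}
    (hG : ∀ y, Measurable[cylinderEvents (X := fun _ : ι => E) Δ'] (G y)) :
    ∫⁻ t, G (Y t) t ∂Measure.infinitePi ν
      = ∫⁻ t, (∫⁻ t', G (Y t) t' ∂Measure.infinitePi ν) ∂Measure.infinitePi ν := by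
  classical
  set μ := Measure.infinitePi ν
  have hdec : ∀ (H : F → (ι → E) → ℝ≥0∞) t,
      H (Y t) t = ∑' y, (if Y t = y then 1 else 0) * H y t := fun H t => by
    rw [tsum_eq_single (Y t) fun y hy => by rw [if_neg hy.symm, zero_mul], if_pos rfl, one_mul]
  have hind : ∀ y, Measurable[cylinderEvents (X := fun _ : ι => E) Δ]
      fun t => if Y t = y then (1 : ℝ≥0∞) else 0 := fun y =>
    Measurable.ite (hY (measurableSet_singleton y)) measurable_const measurable_const
  have hind' : ∀ y, Measurable fun t => if Y t = y then (1 : ℝ≥0∞) else 0 := fun y =>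
    (hind y).mono cylinderEvents_le_pi le_rfl
  have hprod : ∀ y, Measurable fun t => (if Y t = y then (1 : ℝ≥0∞) else 0) * G y t := fun y =>
    (hind' y).mul ((hG y).mono cylinderEvents_le_pi le_rfl)
  rw [lintegral_congr (hdec G), lintegral_congr (hdec fun y _ => ∫⁻ t', G y t' ∂μ),
    lintegral_tsum fun y => (hprod y).aemeasurable,
    lintegral_tsum fun y => ((hind' y).mul_const _).aemeasurable]
  refine tsum_congr fun y => ?_
  rw [lintegral_mul_of_disjoint ν h (hind y) (hG y), lintegral_mul_const _ (hind' y)]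

theorem lintegral_eval (l : ι) {f : E → ℝ≥0∞} (hf : Measurable f) :
    ∫⁻ t, f (t l) ∂Measure.infinitePi ν = ∫⁻ v, f v ∂ν l :=
  (measurePreserving_eval_infinitePi ν l).lintegral_comp hf

end Product

/-! ### Generating functions and means of the offspring of a population -/

section Offspring

variable {d : ℕ}

/-- The monomial `s₁^{v₁} ⋯ s_d^{v_d}`. As `0 ^ 0 = 1`, it is the indicator of `v = 0` at `s = 0`,
so that a generating function at `0` is the probability of the zero vector. -/
def monomial (s : Fin d → ℝ≥0∞) (v : Fin d → ℕ) : ℝ≥0∞ := ∏ j, s j ^ v j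

theorem monomial_add (s : Fin d → ℝ≥0∞) (v w : Fin d → ℕ) :
    monomial s (v + w) = monomial s v * monomial s w := by
  simp [monomial, pow_add, Finset.prod_mul_distrib]

theorem monomial_zero (s : Fin d → ℝ≥0∞) : monomial s 0 = 1 := by
  simp [monomial]

theorem monomial_sum (s : Fin d → ℝ≥0∞) {α : Type*} (A : Finset α) (v : α → Fin d → ℕ) :
    monomial s (∑ a ∈ A, v a) = ∏ a ∈ A, monomial s (v a) := by
  classical
  induction A using Finset.induction_on with
  | empty => simp [monomial_zero]
  | insert a A ha ih => rw [Finset.sum_insert ha, Finset.prod_insert ha, monomial_add, ih]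

theorem monomial_zero_left (v : Fin d → ℕ) :
    monomial 0 v = if v = 0 then 1 else 0 := by
  split_ifs with h
  · rw [h, monomial_zero]
  · obtain ⟨j, hj⟩ := Function.ne_iff.1 h
    exact Finset.prod_eq_zero (Finset.mem_univ j) (zero_pow hj)

/-- The generating function `s ↦ E(s₁^{v₁} ⋯ s_d^{v_d})` of a law on `ℤ₊ᵈ`. -/
def pgf (κ : Measure (Fin d → ℕ)) (s : Fin d → ℝ≥0∞) : ℝ≥0∞ := ∫⁻ v, monomial s v ∂κ

variable {ι : Type*}

/-- The total offspring of the population `Y` if `t (e i k)` is the offspring of its `k`-th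
particle of type `i`. -/
def offspring (e : Fin d → ℕ → ι) (Y : Fin d → ℕ) (t : ι → Fin d → ℕ) : Fin d → ℕ :=
  ∑ i, ∑ k ∈ Finset.range (Y i), t (e i k)

theorem measurable_offspring {m : MeasurableSpace (ι → Fin d → ℕ)} {e : Fin d → ℕ → ι}
    {Y : (ι → Fin d → ℕ) → Fin d → ℕ} (hY : Measurable[m] Y)
    (he : ∀ i k, Measurable[m] fun t : ι → Fin d → ℕ => t (e i k)) :
    Measurable[m] fun t => offspring e (Y t) t := by
  have h1 : ∀ y, Measurable[m] fun t => offspring e y t := fun y =>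
    Finset.measurable_fun_sum _ fun i _ => Finset.measurable_fun_sum _ fun k _ => he i k
  intro A _
  have h2 : (fun t => offspring e (Y t) t) ⁻¹' A
      = ⋃ y, Y ⁻¹' {y} ∩ (fun t => offspring e y t) ⁻¹' A := by
    ext t
    simp
  rw [h2]
  exact MeasurableSet.iUnion fun y =>
    (hY (measurableSet_singleton y)).inter (h1 y (MeasurableSet.of_discrete))

variable (ν : ι → Measure (Fin d → ℕ)) [∀ l, IsProbabilityMeasure (ν l)]
  {e : Fin d → ℕ → ι} {Δ : Set ι} {Y : (ι → Fin d → ℕ) → Fin d → ℕ}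
  {κ : Fin d → Measure (Fin d → ℕ)}

/-- The branching property: the generating function of the offspring of a population is a
composition. -/
theorem lintegral_monomial_offspring (he : Function.Injective fun x : Fin d × ℕ => e x.1 x.2)
    (hΔ : ∀ i k, e i k ∉ Δ) (hκ : ∀ i k, ν (e i k) = κ i)
    (hY : Measurable[cylinderEvents (X := fun _ : ι => Fin d → ℕ) Δ] Y) (s : Fin d → ℝ≥0∞) :
    ∫⁻ t, monomial s (offspring e (Y t) t) ∂Measure.infinitePi ν
      = ∫⁻ t, monomial (fun i => pgf (κ i) s) (Y t) ∂Measure.infinitePi ν := by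
  have hm : Measurable (monomial s) := Measurable.of_discrete
  have hG : ∀ y, Measurable[cylinderEvents (X := fun _ : ι => Fin d → ℕ) Δᶜ]
      fun t => monomial s (offspring e y t) := fun y =>
    hm.comp (measurable_offspring measurable_const fun i k =>
      measurable_cylinderEvent_apply (hΔ i k))
  rw [lintegral_freeze ν disjoint_compl_right hY hG]
  refine lintegral_congr fun t => ?_
  set y := Y t
  have h1 : ∀ t' : ι → Fin d → ℕ, monomial s (offspring e y t')
      = ∏ x ∈ Finset.univ.sigma fun i => Finset.range (y i), monomial s (t' (e x.1 x.2)) :=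
    fun t' => by rw [offspring, Finset.sum_sigma', monomial_sum]
  have hinj : Function.Injective fun x : (_ : Fin d) × ℕ => e x.1 x.2 := fun x x' hx => by
    have := @he (x.1, x.2) (x'.1, x'.2) hx
    ext <;> simp_all
  rw [lintegral_congr h1, lintegral_prod_eq_prod_lintegral_of_indepFun
    (Finset.univ.sigma fun i => Finset.range (y i))
    (fun (x : (_ : Fin d) × ℕ) (t' : ι → Fin d → ℕ) => monomial s (t' (e x.1 x.2)))
    ((iIndepFun_infinitePi (P := ν) (X := fun _ v => monomial s v) fun _ => hm).precomp hinj)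
    fun x => hm.comp (measurable_pi_apply _)]
  simp only [lintegral_eval ν _ hm, hκ]
  rw [Finset.prod_sigma]
  simp [monomial, pgf]

/-- Each particle of type `i` contributes the mean of its offspring law. -/
theorem lintegral_offspring (hΔ : ∀ i k, e i k ∉ Δ) (hκ : ∀ i k, ν (e i k) = κ i)
    (hY : Measurable[cylinderEvents (X := fun _ : ι => Fin d → ℕ) Δ] Y) (j : Fin d) :
    ∫⁻ t, (offspring e (Y t) t j : ℝ≥0∞) ∂Measure.infinitePi ν
      = ∑ i, (∫⁻ v, (v j : ℝ≥0∞) ∂κ i) * ∫⁻ t, (Y t i : ℝ≥0∞) ∂Measure.infinitePi ν := by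
  have hm : ∀ j, Measurable fun v : Fin d → ℕ => (v j : ℝ≥0∞) := fun j => Measurable.of_discrete
  have hG : ∀ y, Measurable[cylinderEvents (X := fun _ : ι => Fin d → ℕ) Δᶜ]
      fun t => (offspring e y t j : ℝ≥0∞) := fun y =>
    (hm j).comp (measurable_offspring measurable_const fun i k =>
      measurable_cylinderEvent_apply (hΔ i k))
  have hY' : ∀ i, Measurable fun t => (Y t i : ℝ≥0∞) := fun i =>
    (hm i).comp (hY.mono cylinderEvents_le_pi le_rfl)
  rw [lintegral_freeze ν disjoint_compl_right hY hG]
  have h1 : ∀ y : Fin d → ℕ, ∫⁻ t, (offspring e y t j : ℝ≥0∞) ∂Measure.infinitePi ν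
      = ∑ i, (∫⁻ v, (v j : ℝ≥0∞) ∂κ i) * y i := fun y => by
    simp only [offspring, Finset.sum_apply, Nat.cast_sum]
    have hm' : ∀ i k, Measurable fun t : ι → Fin d → ℕ => (t (e i k) j : ℝ≥0∞) := fun i k =>
      (hm j).comp (measurable_pi_apply _)
    rw [lintegral_finsetSum _ fun i _ => Finset.measurable_fun_sum _ fun k _ => hm' i k]
    refine Finset.sum_congr rfl fun i _ => ?_
    rw [lintegral_finsetSum _ fun k _ => hm' i k]
    simp [fun k => lintegral_eval ν (e i k) (hm j), hκ, mul_comm]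
  simp only [h1]
  rw [lintegral_finsetSum _ fun i _ => (hY' i).const_mul _]
  exact Finset.sum_congr rfl fun i _ => lintegral_const_mul _ (hY' i)

end Offspring

/-! ### Quenched generating functions and means of the process -/

section Quenched

variable {S : Type*} {d : ℕ}

/-- The shift of environments by an integer, `(shiftBy k ω)ₙ = ωₙ₊ₖ`. -/
def shiftBy (k : ℤ) (ω : ℤ → S) : ℤ → S := fun n => ω (n + k)

theorem shiftBy_apply (k n : ℤ) (ω : ℤ → S) : shiftBy k ω n = ω (n + k) := rfl

theorem shiftBy_zero (ω : ℤ → S) : shiftBy 0 ω = ω := by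
  funext n; simp [shiftBy]

theorem shiftBy_shiftBy (k l : ℤ) (ω : ℤ → S) : shiftBy k (shiftBy l ω) = shiftBy (k + l) ω := by
  funext n; simp [shiftBy, add_assoc]

variable [MeasurableSpace S] (q : Kernel S (Fin d → ℕ)) (p : Fin d → Kernel S (Fin d → ℕ))

/-- The generating function of the offspring laws, one component for each type of the parent. -/
def offspringPgf (x : S) (s : Fin d → ℝ≥0∞) : Fin d → ℝ≥0∞ := fun i => pgf (p i x) s

/-- The generating function of the `n`-th generation of the branching process without immigration,
one component for each type of the ancestor at time `0`. -/
def treePgf : ℕ → (ℤ → S) → (Fin d → ℝ≥0∞) → Fin d → ℝ≥0∞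
  | 0, _, s => s
  | n + 1, ω, s => treePgf n ω (offspringPgf p (ω n) s)

/-- The generating function of `Zₙ` for the process started from `0`. -/
def immPgf : ℕ → (ℤ → S) → (Fin d → ℝ≥0∞) → ℝ≥0∞
  | 0, _, _ => 1
  | n + 1, ω, s =>
    immPgf n ω (offspringPgf p (ω n) s) * pgf (q (ω (n - 1))) (offspringPgf p (ω n) s)

theorem treePgf_add (n m : ℕ) (ω : ℤ → S) (s : Fin d → ℝ≥0∞) :
    treePgf p (n + m) ω s = treePgf p n ω (treePgf p m (shiftBy n ω) s) := by
  induction m generalizing s with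
  | zero => rfl
  | succ m ih =>
    rw [← add_assoc]
    simp only [treePgf]
    rw [ih, shiftBy_apply]
    push_cast
    rw [add_comm (m : ℤ) n]

/-- The process at time `n + m` consists of the descendants of the particles of time `n` and of
those of the later immigrants. -/
theorem immPgf_add (n m : ℕ) (ω : ℤ → S) (s : Fin d → ℝ≥0∞) :
    immPgf q p (n + m) ω s
      = immPgf q p n ω (treePgf p m (shiftBy n ω) s) * immPgf q p m (shiftBy n ω) s := by
  induction m generalizing s with
  | zero => simp [immPgf, treePgf]
  | succ m ih =>
    rw [← add_assoc]
    simp only [immPgf, treePgf]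
    rw [ih, shiftBy_apply, shiftBy_apply, mul_assoc]
    push_cast
    rw [add_comm (m : ℤ) n, show (m : ℤ) - 1 + n = n + m - 1 by ring]

/-- The descendants of the immigrants of time `0` are split off. -/
theorem immPgf_succ' (n : ℕ) (ω : ℤ → S) (s : Fin d → ℝ≥0∞) :
    immPgf q p (n + 1) ω s
      = pgf (q (ω (-1))) (treePgf p (n + 1) ω s) * immPgf q p n (shiftBy 1 ω) s := by
  rw [add_comm, immPgf_add, treePgf_add]
  simp [immPgf, treePgf]

/-- The labels of the vectors that determine `Zₙ`. -/
def pastLabels (d n : ℕ) : Set (Label d) := {l | Sum.elim (fun k => k) (fun x => x.1) l < n}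

theorem Z_eq_offspring (z : Fin d → ℕ) (t : Trees d) (n : ℕ) :
    Z z t (n + 1) = offspring (fun i k => Sum.inr (n, i, k)) (Z z t n + t (.inl n)) t := rfl

theorem measurable_Z_past (z : Fin d → ℕ) (n : ℕ) :
    Measurable[cylinderEvents (X := fun _ : Label d => Fin d → ℕ) (pastLabels d n)]
      fun t => Z z t n := by
  induction n with
  | zero => exact measurable_const
  | succ n ih =>
    have hmono : pastLabels d n ⊆ pastLabels d (n + 1) := fun l hl => lt_trans hl n.lt_succ_self
    refine measurable_offspring (Y := fun t => Z z t n + t (.inl n)) ?_ fun i k =>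
      measurable_cylinderEvent_apply (by simp [pastLabels])
    exact (ih.mono (cylinderEvents_mono hmono) le_rfl).add
      (measurable_cylinderEvent_apply (by simp [pastLabels]))

theorem measurable_Z (z : Fin d → ℕ) (n : ℕ) : Measurable fun t : Trees d => Z z t n :=
  (measurable_Z_past z n).mono cylinderEvents_le_pi le_rfl

variable [IsMarkovKernel q] [∀ i, IsMarkovKernel (p i)]

instance : IsMarkovKernel (quenched q p) :=
  inferInstanceAs (IsMarkovKernel (prodKernel (labelLaw q p)))

theorem quenched_apply (ω : ℤ → S) :
    quenched q p ω = Measure.infinitePi fun l => labelLaw q p l ω := rfl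

theorem disjoint_pastLabels_imm (n : ℕ) : Disjoint (pastLabels d n) {.inl n} := by
  simp [pastLabels]

/-- The population `Zₙ + Xₙ` is determined before the offspring at time `n`. -/
theorem measurable_Z_add_imm (z : Fin d → ℕ) (n : ℕ) :
    Measurable[cylinderEvents (X := fun _ : Label d => Fin d → ℕ)
      (pastLabels d n ∪ {.inl n})] fun t => Z z t n + t (.inl n) :=
  ((measurable_Z_past z n).mono (cylinderEvents_mono Set.subset_union_left) le_rfl).add
    (measurable_cylinderEvent_apply (by simp))

/-- The quenched generating function of `Zₙ`: the descendants of the `z` initial particles and of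
the immigrants are independent. -/
theorem lintegral_monomial_Z (ω : ℤ → S) (z : Fin d → ℕ) (n : ℕ) (s : Fin d → ℝ≥0∞) :
    ∫⁻ t, monomial s (Z z t n) ∂quenched q p ω
      = immPgf q p n ω s * monomial (treePgf p n ω s) z := by
  induction n generalizing s with
  | zero => simp [Z, immPgf, treePgf]
  | succ n ih =>
    simp only [Z_eq_offspring, quenched_apply]
    rw [lintegral_monomial_offspring (fun l => labelLaw q p l ω)
      (Δ := pastLabels d n ∪ {.inl n}) (Y := fun t => Z z t n + t (.inl n))
      (κ := fun i => p i (ω n)) (fun x y hxy => by simpa [Prod.ext_iff] using hxy)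
      (fun i k => by simp [pastLabels]) (fun i k => rfl) (measurable_Z_add_imm z n)]
    have hm : ∀ r : Fin d → ℝ≥0∞, Measurable (monomial r) := fun r => Measurable.of_discrete
    simp only [monomial_add]
    rw [lintegral_mul_of_disjoint (fun l => labelLaw q p l ω) (disjoint_pastLabels_imm n)
      (f := fun t => monomial (fun i => pgf (p i (ω n)) s) (Z z t n))
      (g := fun t => monomial (fun i => pgf (p i (ω n)) s) (t (.inl n)))
      ((hm _).comp (measurable_Z_past z n))
      ((hm _).comp (measurable_cylinderEvent_apply (Set.mem_singleton _))),
      lintegral_eval (fun l => labelLaw q p l ω) _ (hm _), ← quenched_apply, ih]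
    simp only [immPgf, treePgf]
    rw [mul_right_comm]
    rfl

theorem quenched_Z_eq_zero (ω : ℤ → S) (z : Fin d → ℕ) (n : ℕ) :
    quenched q p ω {t | Z z t n = 0} = immPgf q p n ω 0 * monomial (treePgf p n ω 0) z := by
  have hms : MeasurableSet {t : Trees d | Z z t n = 0} :=
    measurable_Z z n (measurableSet_singleton 0)
  rw [← lintegral_monomial_Z, ← lintegral_indicator_one hms]
  refine lintegral_congr fun t => ?_
  simp [monomial_zero_left, Set.indicator_apply]

/-- The quenched mean of `Zₙ` for the process started from `0`. -/
def meanZ (n : ℕ) (ω : ℤ → S) : Fin d → ℝ≥0∞ :=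
  fun j => ∫⁻ t, (Z 0 t n j : ℝ≥0∞) ∂quenched q p ω

theorem meanZ_zero (ω : ℤ → S) : meanZ q p 0 ω = 0 := by
  funext j; simp [meanZ, Z]

theorem meanZ_succ (n : ℕ) (ω : ℤ → S) :
    meanZ q p (n + 1) ω = (meanMatrix p n ω).mulVec (meanZ q p n ω + immMean q n ω) := by
  have hm : ∀ j, Measurable fun v : Fin d → ℕ => (v j : ℝ≥0∞) := fun j => Measurable.of_discrete
  funext j
  simp only [meanZ, Z_eq_offspring, quenched_apply]
  rw [lintegral_offspring (fun l => labelLaw q p l ω)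
    (Δ := pastLabels d n ∪ {.inl n}) (Y := fun t => Z 0 t n + t (.inl n))
    (κ := fun i => p i (ω n)) (fun i k => by simp [pastLabels]) (fun i k => rfl)
    (measurable_Z_add_imm 0 n)]
  simp only [Matrix.mulVec, dotProduct, Pi.add_apply, Nat.cast_add]
  refine Finset.sum_congr rfl fun i _ => ?_
  congr 1
  rw [lintegral_add_left (f := fun t => (Z 0 t n i : ℝ≥0∞)) ((hm i).comp (measurable_Z 0 n)),
    lintegral_eval (fun l => labelLaw q p l ω) _ (hm i)]
  rfl

end Quenched

/-! ### The stationary version at time zero -/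

section Wave

variable {S : Type*} {d : ℕ}

/-- The labels of the line of descent of the immigrants of time `i`. -/
def waveLabels (d : ℕ) (i : ℤ) : Set (WaveLabel d) :=
  {l | Sum.elim (fun k => k) (fun x => x.1) l = i}

/-- The labels that determine the `k`-th generation of the descendants of the immigrants of time
`i`. -/
def wavePast (d : ℕ) (i : ℤ) (k : ℕ) : Set (WaveLabel d) :=
  {l | Sum.elim (fun j => j = i) (fun x => x.1 = i ∧ x.2.1 < k) l}

theorem U_eq_offspring (t : WaveTrees d) (i : ℤ) (k : ℕ) :
    U t i (k + 1) = offspring (fun j m => Sum.inr (i, k, j, m)) (U t i k) t := rfl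

theorem measurable_U_past (i : ℤ) (k : ℕ) :
    Measurable[cylinderEvents (X := fun _ : WaveLabel d => Fin d → ℕ) (wavePast d i k)]
      fun t => U t i k := by
  induction k with
  | zero => exact measurable_cylinderEvent_apply (by simp [wavePast])
  | succ k ih =>
    have hmono : wavePast d i k ⊆ wavePast d i (k + 1) := by
      rintro (l | l) hl
      · exact hl
      · exact ⟨hl.1, lt_trans hl.2 k.lt_succ_self⟩
    exact measurable_offspring (Y := fun t => U t i k)
      (ih.mono (cylinderEvents_mono hmono) le_rfl) fun j m =>
      measurable_cylinderEvent_apply (by simp [wavePast])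

theorem measurable_U_wave (i : ℤ) (k : ℕ) :
    Measurable[cylinderEvents (X := fun _ : WaveLabel d => Fin d → ℕ) (waveLabels d i)]
      fun t => U t i k := by
  refine (measurable_U_past i k).mono (cylinderEvents_mono ?_) le_rfl
  rintro (l | l) hl
  · exact hl
  · exact hl.1

theorem measurable_U (i : ℤ) (k : ℕ) : Measurable fun t : WaveTrees d => U t i k :=
  (measurable_U_wave i k).mono cylinderEvents_le_pi le_rfl

variable [MeasurableSpace S] (q : Kernel S (Fin d → ℕ)) (p : Fin d → Kernel S (Fin d → ℕ))
  [IsMarkovKernel q] [∀ i, IsMarkovKernel (p i)]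

instance : IsMarkovKernel (waveQuenched q p) :=
  inferInstanceAs (IsMarkovKernel (prodKernel (waveLabelLaw q p)))

theorem waveQuenched_apply (ω : ℤ → S) :
    waveQuenched q p ω = Measure.infinitePi fun l => waveLabelLaw q p l ω := rfl

theorem lintegral_monomial_U (ω : ℤ → S) (i : ℤ) (k : ℕ) (s : Fin d → ℝ≥0∞) :
    ∫⁻ t, monomial s (U t i k) ∂waveQuenched q p ω
      = pgf (q (ω (i - 1))) (treePgf p k (shiftBy i ω) s) := by
  induction k generalizing s with
  | zero =>
    simp only [U, waveQuenched_apply]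
    rw [lintegral_eval (fun l => waveLabelLaw q p l ω) _ Measurable.of_discrete]
    rfl
  | succ k ih =>
    simp only [U_eq_offspring, waveQuenched_apply]
    rw [lintegral_monomial_offspring (fun l => waveLabelLaw q p l ω)
      (Δ := wavePast d i k) (Y := fun t => U t i k)
      (κ := fun j => p j (ω (i + k))) (fun x y hxy => by simpa [Prod.ext_iff] using hxy)
      (fun j m => by simp [wavePast]) (fun j m => rfl) (measurable_U_past i k),
      ← waveQuenched_apply, ih]
    simp only [treePgf]
    rw [shiftBy_apply, add_comm (k : ℤ) i]
    rfl

/-- The immigrants of the times `-n, …, -1` have no descendants at time `0`. -/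
def deadWaves (d n : ℕ) : Set (WaveTrees d) :=
  {t | ∀ k < n, U t (-((k : ℤ) + 1)) (k + 1) = 0}

theorem measurableSet_deadWaves (n : ℕ) : MeasurableSet (deadWaves d n) := by
  have : deadWaves d n
      = ⋂ k, ⋂ (_ : k < n), {t | U t (-((k : ℤ) + 1)) (k + 1) = 0} := by
    ext t; simp [deadWaves]
  rw [this]
  exact MeasurableSet.iInter fun k => MeasurableSet.iInter fun _ =>
    measurable_U _ _ (measurableSet_singleton 0)

theorem antitone_deadWaves : Antitone (deadWaves d) :=
  fun _ _ hmn _ ht k hk => ht k (hk.trans_le hmn)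

/-- The descendants at time `0` of the immigrants of the last `n` times are distributed as the
process started from `0` at time `-n`. -/
theorem waveQuenched_deadWaves (ω : ℤ → S) (n : ℕ) :
    waveQuenched q p ω (deadWaves d n) = immPgf q p n (shiftBy (-n) ω) 0 := by
  have hm : Measurable (monomial (0 : Fin d → ℝ≥0∞)) := Measurable.of_discrete
  have h1 : waveQuenched q p ω (deadWaves d n)
      = ∫⁻ t, ∏ k ∈ Finset.range n, monomial 0 (U t (-((k : ℤ) + 1)) (k + 1))
        ∂waveQuenched q p ω := by
    rw [← lintegral_indicator_one (measurableSet_deadWaves n)]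
    refine lintegral_congr fun t => ?_
    by_cases ht : t ∈ deadWaves d n
    · rw [Set.indicator_of_mem ht]
      exact (Finset.prod_eq_one fun k hk => by
        rw [ht k (Finset.mem_range.1 hk), monomial_zero]).symm
    · rw [Set.indicator_of_notMem ht]
      simp only [deadWaves, Set.mem_ofPred_eq, not_forall] at ht
      obtain ⟨k, hk, hne⟩ := ht
      exact (Finset.prod_eq_zero (Finset.mem_range.2 hk) (by
        rw [monomial_zero_left, if_neg hne])).symm
  rw [h1]
  clear h1
  induction n with
  | zero => simp [immPgf]
  | succ n ih =>
    have hlab : Disjoint (⋃ k ∈ Finset.range n, waveLabels d (-((k : ℤ) + 1)))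
        (waveLabels d (-((n : ℤ) + 1))) := by
      simp only [Set.disjoint_iUnion_left]
      intro k hk
      refine Set.disjoint_left.2 fun l hl hl' => ?_
      have : -((k : ℤ) + 1) = -((n : ℤ) + 1) := hl.symm.trans hl'
      have := Finset.mem_range.1 hk
      omega
    simp only [Finset.prod_range_succ, waveQuenched_apply]
    rw [lintegral_mul_of_disjoint _ hlab
      (f := fun t => ∏ k ∈ Finset.range n, monomial 0 (U t (-((k : ℤ) + 1)) (k + 1)))
      (g := fun t => monomial 0 (U t (-((n : ℤ) + 1)) (n + 1)))
      (Finset.measurable_fun_prod _ fun k hk => hm.comp ((measurable_U_wave _ _).mono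
        (cylinderEvents_mono (Set.subset_iUnion₂_of_subset k hk subset_rfl)) le_rfl))
      (hm.comp (measurable_U_wave _ _)), ← waveQuenched_apply, ih, lintegral_monomial_U,
      immPgf_succ', shiftBy_shiftBy, mul_comm]
    congr 2
    · push_cast
      rw [shiftBy_apply]
      congr 2
      ring
    · push_cast
      ring_nf

theorem Ztilde_eq_zero_iff (t : WaveTrees d) :
    (∀ j, Ztilde t 0 j = ((0 : Fin d → ℕ) j : ℝ≥0∞)) ↔ t ∈ ⋂ n, deadWaves d n := by
  simp only [Ztilde, Pi.zero_apply, Nat.cast_zero, ENNReal.tsum_eq_zero, Nat.cast_eq_zero,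
    zero_sub, Set.mem_iInter, deadWaves, Set.mem_ofPred_eq]
  exact ⟨fun h n k _ => funext fun j => h j k, fun h j k => congrFun (h (k + 1) k k.lt_succ_self) j⟩

theorem stationaryProb_zero {P : Measure (ℤ → S)} :
    stationaryProb P q p 0 = ∫⁻ ω, waveQuenched q p ω (⋂ n, deadWaves d n) ∂P := by
  unfold stationaryProb
  refine lintegral_congr fun ω => ?_
  congr 1
  ext t
  exact Ztilde_eq_zero_iff t

end Wave

/-! ### The shift on environments and trees -/

section Shift

variable {S : Type*} {d : ℕ}

theorem shift_eq_shiftBy : shift (S := S) = shiftBy 1 := rfl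

/-- The shift by `k` on the labels of the driving vectors. -/
def labelShift (d k : ℕ) : Label d → Label d :=
  Sum.map (fun n => n + k) fun x => (x.1 + k, x.2)

theorem labelShift_injective (k : ℕ) : Function.Injective (labelShift d k) := by
  refine Sum.map_injective.2 ⟨fun a b h => by simpa using h, fun a b h => ?_⟩
  simp only [Prod.mk.injEq, add_left_inj] at h
  exact Prod.ext h.1 h.2

/-- The shift on environments and driving vectors. -/
def jointShift (x : (ℤ → S) × Trees d) : (ℤ → S) × Trees d :=
  (shift x.1, fun l => x.2 (labelShift d 1 l))

theorem jointShift_iterate (k : ℕ) (x : (ℤ → S) × Trees d) :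
    jointShift^[k] x = (shiftBy k x.1, fun l => x.2 (labelShift d k l)) := by
  induction k with
  | zero =>
    refine Prod.ext (shiftBy_zero _).symm (funext fun l => ?_)
    rcases l with l | l <;> rfl
  | succ k ih =>
    rw [Function.iterate_succ_apply', ih]
    refine Prod.ext ?_ (funext fun l => ?_)
    · simp only [jointShift, shift_eq_shiftBy, shiftBy_shiftBy]
      congr 1
      push_cast
      ring
    · rcases l with l | l <;> simp [jointShift, labelShift, add_comm 1 k, add_assoc]

theorem Z_add (z : Fin d → ℕ) (t : Trees d) (m n : ℕ) :
    Z z t (m + n) = Z (Z z t m) (fun l => t (labelShift d m l)) n := by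
  induction n with
  | zero => rfl
  | succ n ih =>
    rw [← add_assoc]
    simp only [Z]
    rw [ih]
    simp [labelShift, add_comm m n]

theorem Z_mono {z z' : Fin d → ℕ} (h : z ≤ z') (t : Trees d) (n : ℕ) : Z z t n ≤ Z z' t n := by
  induction n with
  | zero => exact h
  | succ n ih =>
    simp only [Z]
    gcongr with i _
    exact ih i

/-- By monotonicity in the initial state, a zero at time `m + n` forces a zero at time `n` for the
process restarted from `0` at time `m`. -/
theorem Z_shift_eq_zero {t : Trees d} {m n : ℕ} (h : Z 0 t (m + n) = 0) :
    Z 0 (fun l => t (labelShift d m l)) n = 0 := by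
  rw [Z_add] at h
  have hmono := Z_mono (z := 0) (z' := Z 0 t m) (fun i => Nat.zero_le _)
    (fun l => t (labelShift d m l)) n
  rw [h] at hmono
  exact le_antisymm hmono fun i => Nat.zero_le _

theorem shiftBy_iterate (k : ℤ) (n : ℕ) : (shiftBy (S := S) k)^[n] = shiftBy (n * k) := by
  induction n with
  | zero => funext ω; simp [shiftBy_zero]
  | succ n ih =>
    funext ω
    rw [Function.iterate_succ_apply', ih, shiftBy_shiftBy]
    congr 1
    push_cast
    ring

variable [MeasurableSpace S]

theorem measurable_shiftBy (k : ℤ) : Measurable (shiftBy (S := S) k) :=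
  measurable_pi_lambda _ fun n => measurable_pi_apply (n + k)

/-- The shift of environments as a measurable equivalence. -/
def shiftEquiv (k : ℤ) : (ℤ → S) ≃ᵐ (ℤ → S) where
  toFun := shiftBy k
  invFun := shiftBy (-k)
  left_inv ω := by rw [shiftBy_shiftBy, neg_add_cancel, shiftBy_zero]
  right_inv ω := by rw [shiftBy_shiftBy, add_neg_cancel, shiftBy_zero]
  measurable_toFun := measurable_shiftBy k
  measurable_invFun := measurable_shiftBy (-k)

theorem measurePreserving_shiftBy {P : Measure (ℤ → S)} (hP : MeasurePreserving shift P P)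
    (k : ℤ) : MeasurePreserving (shiftBy k) P P := by
  have h1 : ∀ n : ℕ, MeasurePreserving (shiftBy (n : ℤ)) P P := fun n => by
    have := hP.iterate n
    rwa [shift_eq_shiftBy, shiftBy_iterate, mul_one] at this
  obtain ⟨n, rfl | rfl⟩ := k.eq_nat_or_neg
  · exact h1 n
  · exact MeasurePreserving.symm (shiftEquiv (S := S) n) (h1 n)

variable (q : Kernel S (Fin d → ℕ)) (p : Fin d → Kernel S (Fin d → ℕ))

theorem labelLaw_shift (ω : ℤ → S) (l : Label d) :
    labelLaw q p l (shift ω) = labelLaw q p (labelShift d 1 l) ω := by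
  rcases l with n | ⟨n, i, m⟩
  · simp [labelLaw, labelShift, lawAt, Kernel.comap_apply, shift]
  · simp [labelLaw, labelShift, lawAt, Kernel.comap_apply, shift]

variable [IsMarkovKernel q] [∀ i, IsMarkovKernel (p i)]

theorem quenched_shift (ω : ℤ → S) :
    quenched q p (shift ω)
      = (quenched q p ω).map fun t l => t (labelShift d 1 l) := by
  rw [quenched_apply, quenched_apply,
    Measure.map_infinitePi_infinitePi_of_inj (labelShift_injective 1)]
  simp_rw [labelLaw_shift]

theorem measurable_jointShift : Measurable (jointShift (S := S) (d := d)) :=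
  ((measurable_shiftBy 1).comp measurable_fst).prodMk
    (measurable_pi_lambda _ fun _ => (measurable_pi_apply _).comp measurable_snd)

/-- The section at the shifted environment is the law of the shifted section. -/
theorem quenched_shift_section {A : Set ((ℤ → S) × Trees d)} (hA : MeasurableSet A) (ω : ℤ → S) :
    quenched q p (shift ω) (Prod.mk (shift ω) ⁻¹' A)
      = quenched q p ω (Prod.mk ω ⁻¹' (jointShift ⁻¹' A)) := by
  rw [quenched_shift, Measure.map_apply (measurable_pi_lambda _ fun _ => measurable_pi_apply _)
    (measurable_prodMk_left hA)]
  rfl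

variable {P : Measure (ℤ → S)} [IsProbabilityMeasure P]

theorem measurePreserving_jointShift (hP : MeasurePreserving shift P P) :
    MeasurePreserving jointShift (annealed P q p) (annealed P q p) := by
  refine ⟨measurable_jointShift, Measure.ext fun A hA => ?_⟩
  rw [Measure.map_apply measurable_jointShift hA, annealed,
    Measure.compProd_apply (measurable_jointShift hA), Measure.compProd_apply hA,
    ← hP.lintegral_comp (Kernel.measurable_kernel_prodMk_left hA)]
  exact lintegral_congr fun ω => (quenched_shift_section q p hA ω).symm

/-- The quenched zero-one law: the section of an invariant event is a tail event of the independent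
driving vectors. -/
theorem quenched_section_zero_or_one {A : Set ((ℤ → S) × Trees d)} (hA : MeasurableSet A)
    (hinv : jointShift ⁻¹' A = A) (ω : ℤ → S) :
    quenched q p ω (Prod.mk ω ⁻¹' A) = 0 ∨ quenched q p ω (Prod.mk ω ⁻¹' A) = 1 := by
  rw [quenched_apply]
  refine measure_zero_or_one_of_measurableSet_limsup (f := cofinite) (p := Set.Finite)
    (ns := fun F : Finset (Label d) => (F : Set (Label d)))
    (s := fun l => MeasurableSpace.comap (fun t : Trees d => t l) inferInstance)
    (fun l => (measurable_pi_apply l).comap_le)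
    (iIndepFun_infinitePi (P := fun l => labelLaw q p l ω) (X := fun _ x => x)
      fun _ => measurable_id) (fun t ht => ht.compl_mem_cofinite)
    (Monotone.directed_le fun F F' h => Finset.coe_subset.2 h) (fun F => F.finite_toSet)
    (fun l => ⟨{l}, by simp⟩) ?_
  rw [limsup_eq_iInf_iSup, MeasurableSpace.measurableSet_iInf]
  intro B
  rw [MeasurableSpace.measurableSet_iInf]
  intro hB
  have hfin : (Bᶜ).Finite := mem_cofinite.1 hB
  obtain ⟨k, hk⟩ : ∃ k : ℕ, ∀ l ∈ Bᶜ, Sum.elim (fun n => n) (fun x => x.1) l < k := by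
    obtain ⟨k, hk⟩ := (hfin.image (Sum.elim (fun n => n) fun x => x.1)).bddAbove
    exact ⟨k + 1, fun l hl => Nat.lt_succ_of_le (hk ⟨l, hl, rfl⟩)⟩
  have hrange : ∀ l, labelShift d k l ∈ B := fun l => by
    by_contra hcon
    have := hk _ hcon
    rcases l with l | l <;> simp [labelShift] at this
  have hsec : Prod.mk ω ⁻¹' A = (fun (t : Trees d) l => t (labelShift d k l)) ⁻¹'
      (Prod.mk (shiftBy (k : ℤ) ω) ⁻¹' A) := by
    have : jointShift^[k] ⁻¹' A = A := Set.preimage_iterate_eq ▸ by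
      exact Function.iterate_fixed hinv k
    ext t
    conv_lhs => rw [← this]
    simp only [Set.mem_preimage, jointShift_iterate]
  rw [hsec]
  have hmeas : Measurable[cylinderEvents (X := fun _ : Label d => Fin d → ℕ) B]
      fun (t : Trees d) l => t (labelShift d k l) := by
    rw [@measurable_pi_iff]
    exact fun l => measurable_cylinderEvent_apply (hrange l)
  exact hmeas (measurable_prodMk_left hA)

/-- The environment together with independent driving vectors is ergodic under the shift. -/
theorem ergodic_jointShift (hP : Ergodic shift P) : Ergodic jointShift (annealed P q p) := by
  refine { measurePreserving_jointShift q p hP.toMeasurePreserving with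
    aeconst_set := fun A hA hinv => ?_ }
  set h : (ℤ → S) → ℝ≥0∞ := fun ω => quenched q p ω (Prod.mk ω ⁻¹' A) with hh
  have hm : Measurable h := Kernel.measurable_kernel_prodMk_left hA
  have hshift : ∀ ω, h (shift ω) = h ω := fun ω => by
    simp only [hh]
    rw [quenched_shift_section q p hA, hinv]
  rw [eventuallyConst_set]
  rcases hP.toPreErgodic.ae_mem_or_ae_notMem (s := h ⁻¹' {1}) (hm (measurableSet_singleton 1))
    (by ext ω; simp [hshift]) with h1 | h1
  · left
    rw [annealed]
    refine (Measure.ae_compProd_iff hA).2 ?_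
    filter_upwards [h1] with ω hω
    exact (prob_compl_eq_zero_iff (measurable_prodMk_left hA)).2 hω
  · right
    rw [annealed]
    refine (Measure.ae_compProd_iff hA.compl).2 ?_
    filter_upwards [h1] with ω hω
    refine (measure_eq_zero_iff_ae_notMem).1 ?_
    exact (quenched_section_zero_or_one q p hA hinv ω).resolve_right hω

/-! ### The probability of a zero -/

/-- By stationarity, the process started at time `0` and observed at time `n` may be started at time
`-n` and observed at time `0`. -/
theorem annealed_Z_eq_zero (hP : MeasurePreserving shift P P) (n : ℕ) :
    annealed P q p {x | Z 0 x.2 n = 0} = ∫⁻ ω, waveQuenched q p ω (deadWaves d n) ∂P := by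
  have hms : MeasurableSet {t : Trees d | Z 0 t n = 0} :=
    measurable_Z 0 n (measurableSet_singleton 0)
  have h1 : annealed P q p {x | Z 0 x.2 n = 0}
      = ∫⁻ ω, quenched q p ω {t | Z 0 t n = 0} ∂P := by
    have hms' : MeasurableSet {x : (ℤ → S) × Trees d | Z 0 x.2 n = 0} := measurable_snd hms
    rw [annealed, Measure.compProd_apply hms']
    rfl
  rw [h1, ← (measurePreserving_shiftBy hP (-n)).lintegral_comp (Kernel.measurable_coe _ hms)]
  refine lintegral_congr fun ω => ?_
  rw [waveQuenched_deadWaves, quenched_Z_eq_zero, monomial_zero, mul_one]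

theorem stationaryProb_le_one : stationaryProb P q p 0 ≤ 1 := by
  rw [stationaryProb_zero]
  calc _ ≤ ∫⁻ _, 1 ∂P := lintegral_mono fun ω => prob_le_one
    _ = 1 := by simp

theorem tendsto_annealed_Z_eq_zero (hP : MeasurePreserving shift P P) :
    Tendsto (fun n => annealed P q p {x | Z 0 x.2 n = 0}) atTop (𝓝 (stationaryProb P q p 0)) := by
  have hbind : ∀ A, MeasurableSet A →
      (P.bind (waveQuenched q p)) A = ∫⁻ ω, waveQuenched q p ω A ∂P := fun A hA =>
    Measure.bind_apply hA (waveQuenched q p).aemeasurable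
  simp_rw [annealed_Z_eq_zero q p hP, stationaryProb_zero]
  simp_rw [← hbind _ (measurableSet_deadWaves _),
    ← hbind _ (MeasurableSet.iInter measurableSet_deadWaves)]
  exact tendsto_measure_iInter_atTop (fun n => (measurableSet_deadWaves n).nullMeasurableSet)
    antitone_deadWaves ⟨0, measure_ne_top _ _⟩

/-- The frequency of the zeros of the process is `π(0)`. -/
theorem tendsto_count_zero (hP : Ergodic shift P) :
    ∀ᵐ x ∂annealed P q p, Tendsto (fun n : ℕ => (Nat.count (fun k => Z 0 x.2 k = 0) n : ℝ) / n)
      atTop (𝓝 (stationaryProb P q p 0).toReal) := by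
  have : IsProbabilityMeasure (annealed P q p) := by unfold annealed; infer_instance
  have hlim := (ENNReal.tendsto_toReal (ne_top_of_le_ne_top ENNReal.one_ne_top
    (stationaryProb_le_one q p))).comp (tendsto_annealed_Z_eq_zero q p hP.toMeasurePreserving)
  have key := tendsto_frequency_of_subset_preimage (ergodic_jointShift q p hP)
    (A := fun n => {x | Z 0 x.2 n = 0})
    (fun n => ((measurable_Z 0 n).comp measurable_snd) (measurableSet_singleton 0))
    (fun m n x hx => by
      rw [Set.mem_preimage, jointShift_iterate]
      exact Z_shift_eq_zero hx) hlim
  filter_upwards [key] with x hx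
  refine hx.congr fun n => ?_
  rw [Nat.count_eq_card_filter_range, Finset.card_filter]
  simp [Set.indicator_apply]

end Shift

/-! ### Norms and positive logarithms -/

section Norms

variable {d : ℕ}

theorem norm1_add (v w : Fin d → ℝ≥0∞) : norm1 (v + w) = norm1 v + norm1 w := by
  simp [norm1, Finset.sum_add_distrib]

theorem norm1_mulVec_le (A : Matrix (Fin d) (Fin d) ℝ≥0∞) (v : Fin d → ℝ≥0∞) :
    norm1 (A.mulVec v) ≤ opNorm1 A * norm1 v := by
  rw [opNorm1_eq]
  calc norm1 (A.mulVec v) = ∑ i, (∑ j, A j i) * v i := by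
        simp only [norm1, Matrix.mulVec, dotProduct, Finset.sum_mul]
        exact Finset.sum_comm
    _ ≤ ∑ i, (⨆ i, ∑ j, A j i) * v i := by
        gcongr with i _
        exact le_iSup (fun i => ∑ j, A j i) i
    _ = _ := by rw [norm1, Finset.mul_sum]

theorem opNorm1_mul_le (A B : Matrix (Fin d) (Fin d) ℝ≥0∞) :
    opNorm1 (A * B) ≤ opNorm1 A * opNorm1 B := by
  refine iSup₂_le fun v hv => ?_
  rw [← Matrix.mulVec_mulVec]
  refine (norm1_mulVec_le A _).trans ?_
  gcongr
  exact le_iSup₂_of_le v hv le_rfl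

theorem opNorm1_one_le : opNorm1 (1 : Matrix (Fin d) (Fin d) ℝ≥0∞) ≤ 1 :=
  iSup₂_le fun v hv => by rwa [Matrix.one_mulVec]

/-- The positive part of the logarithm, with `posLog ∞ = ∞`. -/
def posLog (x : ℝ≥0∞) : ℝ≥0∞ := (ENNReal.log x).toENNReal

theorem posLog_mono : Monotone posLog := fun _ _ h =>
  EReal.toENNReal_le_toENNReal (ENNReal.log_monotone h)

theorem posLog_mul_le (x y : ℝ≥0∞) : posLog (x * y) ≤ posLog x + posLog y := by
  unfold posLog
  rw [ENNReal.log_mul_add]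
  exact EReal.toENNReal_add_le

theorem posLog_add_le (x y : ℝ≥0∞) : posLog (x + y) ≤ posLog 2 + (posLog x + posLog y) := by
  have h1 : x + y ≤ 2 * max x y := by
    rw [two_mul]
    exact add_le_add (le_max_left _ _) (le_max_right _ _)
  refine (posLog_mono h1).trans ((posLog_mul_le _ _).trans ?_)
  gcongr
  rcases max_choice x y with h | h <;> rw [h]
  · exact le_self_add
  · exact le_add_self

theorem posLog_two_lt_top : posLog 2 < ∞ := by
  rw [posLog, lt_top_iff_ne_top, EReal.toENNReal_ne_top_iff, Ne, ENNReal.log_eq_top_iff]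
  exact ENNReal.ofNat_ne_top

theorem measurable_posLog : Measurable posLog :=
  measurable_id.ennreal_log.ereal_toENNReal

theorem lt_top_of_posLog_lt_top {x : ℝ≥0∞} (h : posLog x < ∞) : x < ∞ :=
  lt_top_iff_ne_top.2 fun hx => by simp [posLog, hx] at h

theorem eexp_comp {Ω : Type*} [MeasurableSpace Ω] {P : Measure Ω} {T : Ω → Ω}
    (hT : MeasurePreserving T P P) {f : Ω → EReal} (hf : Measurable f) :
    eexp P (fun ω => f (T ω)) = eexp P f := by
  unfold eexp
  rw [hT.lintegral_comp (f := fun ω => (f ω).toENNReal) hf.ereal_toENNReal,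
    hT.lintegral_comp (f := fun ω => (-f ω).toENNReal) hf.neg.ereal_toENNReal]

end Norms

/-! ### Quenched means of the stationary version -/

section Subcritical

variable {S : Type*} [MeasurableSpace S] {d : ℕ} (q : Kernel S (Fin d → ℕ))
  (p : Fin d → Kernel S (Fin d → ℕ))

theorem meanMatrix_shiftBy (n m : ℤ) (ω : ℤ → S) :
    meanMatrix p m (shiftBy n ω) = meanMatrix p (m + n) ω := rfl

theorem immMean_shiftBy (n m : ℤ) (ω : ℤ → S) :
    immMean q m (shiftBy n ω) = immMean q (m + n) ω := by
  have h : lawAt q (m - 1) (shiftBy n ω) = lawAt q (m + n - 1) ω := by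
    change q (ω (m - 1 + n)) = q (ω (m + n - 1))
    rw [show m - 1 + n = m + n - 1 by ring]
  funext j
  simp only [immMean, h]

theorem meanProd_add (n m : ℕ) (ω : ℤ → S) :
    meanProd p (n + m) ω = meanProd p m (shiftBy n ω) * meanProd p n ω := by
  induction m with
  | zero => simp [meanProd]
  | succ m ih =>
    rw [← add_assoc]
    simp only [meanProd]
    rw [ih, meanMatrix_shiftBy, ← mul_assoc]
    push_cast
    rw [add_comm (m : ℤ) n]

theorem measurable_meanMatrix (n : ℤ) (i j : Fin d) :
    Measurable fun ω => meanMatrix p n ω i j :=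
  Measurable.lintegral_kernel Measurable.of_discrete

theorem measurable_opNorm1_meanMatrix (n : ℤ) :
    Measurable fun ω => opNorm1 (meanMatrix p n ω) := by
  simp only [opNorm1_eq]
  exact Measurable.iSup fun i => Finset.measurable_fun_sum _ fun j _ =>
    measurable_meanMatrix p n j i

theorem measurable_opNorm1_meanProd (n : ℕ) :
    Measurable fun ω => opNorm1 (meanProd p n ω) := by
  have h : ∀ i j, Measurable fun ω => meanProd p n ω i j := by
    induction n with
    | zero => exact fun i j => measurable_const
    | succ n ih =>
      intro i j
      simp only [meanProd, Matrix.mul_apply]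
      exact Finset.measurable_fun_sum _ fun k _ => (measurable_meanMatrix p n i k).mul (ih k j)
  simp only [opNorm1_eq]
  exact Measurable.iSup fun i => Finset.measurable_fun_sum _ fun j _ => h j i

theorem measurable_norm1_immMean (n : ℤ) : Measurable fun ω => norm1 (immMean q n ω) :=
  Finset.measurable_fun_sum _ fun _ _ => Measurable.lintegral_kernel Measurable.of_discrete

theorem opNorm1_meanProd_le_prod (N k : ℕ) (ω : ℤ → S) :
    opNorm1 (meanProd p (k * N) (shiftBy (-(k * N : ℕ)) ω))
      ≤ ∏ l ∈ Finset.range k,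
        opNorm1 (meanProd p N (shiftBy (-N) ((shiftBy (-(N : ℤ)))^[l] ω))) := by
  induction k with
  | zero =>
    rw [zero_mul]
    exact opNorm1_one_le
  | succ k ih =>
    rw [Finset.prod_range_succ, shiftBy_iterate, shiftBy_shiftBy,
      show -(N : ℤ) + (k : ℤ) * -(N : ℤ) = -(((k + 1) * N : ℕ) : ℤ) by push_cast; ring,
      show (k + 1) * N = N + k * N by ring, meanProd_add, shiftBy_shiftBy,
      show (N : ℤ) + -((N + k * N : ℕ) : ℤ) = -((k * N : ℕ) : ℤ) by push_cast; ring]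
    exact (opNorm1_mul_le _ _).trans (mul_le_mul_left ih _)

section Moments

variable {P : Measure (ℤ → S)} {q p}

theorem lintegral_posLog_meanMatrix (hP : MeasurePreserving shift P P) (hA : Subcritical P q p)
    (n : ℤ) : ∫⁻ ω, posLog (opNorm1 (meanMatrix p n ω)) ∂P < ∞ := by
  have h := (measurePreserving_shiftBy hP n).lintegral_comp
    (measurable_posLog.comp (measurable_opNorm1_meanMatrix p 0))
  simp only [Function.comp_apply, meanMatrix_shiftBy, zero_add] at h
  rw [h]
  exact hA.A2

theorem lintegral_posLog_immMean (hP : MeasurePreserving shift P P) (hA : Subcritical P q p)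
    (n : ℤ) : ∫⁻ ω, posLog (norm1 (immMean q n ω)) ∂P < ∞ := by
  have h := (measurePreserving_shiftBy hP n).lintegral_comp
    (measurable_posLog.comp (measurable_norm1_immMean q 0))
  simp only [Function.comp_apply, immMean_shiftBy, zero_add] at h
  rw [h]
  exact hA.A1

theorem lintegral_posLog_meanProd (hP : MeasurePreserving shift P P) (hA : Subcritical P q p)
    (n : ℕ) : ∫⁻ ω, posLog (opNorm1 (meanProd p n ω)) ∂P < ∞ := by
  induction n with
  | zero =>
    have : ∀ ω, posLog (opNorm1 (meanProd p 0 ω)) = 0 := fun ω => by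
      rw [posLog, EReal.toENNReal_eq_zero_iff, ENNReal.log_le_zero_iff]
      exact opNorm1_one_le
    simp [this]
  | succ n ih =>
    refine (lintegral_mono fun ω => (posLog_mono (opNorm1_mul_le _ _)).trans
      (posLog_mul_le _ _)).trans_lt ?_
    rw [lintegral_add_left (f := fun ω => posLog (opNorm1 (meanMatrix p n ω)))
      (measurable_posLog.comp (measurable_opNorm1_meanMatrix p n))]
    exact ENNReal.add_lt_top.2 ⟨lintegral_posLog_meanMatrix hP hA n, ih⟩

/-- Along some fixed number of generations the process contracts on average. -/
theorem exists_eexp_log_meanProd_neg (hA : Subcritical P q p) :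
    ∃ N : ℕ, 1 ≤ N ∧ eexp P (fun ω => ENNReal.log (opNorm1 (meanProd p N ω))) < 0 := by
  obtain ⟨γ, hγ, hlim⟩ := hA.A3
  obtain ⟨N, hN, hN1⟩ :=
    ((hlim.eventually (gt_mem_nhds hγ)).and (eventually_ge_atTop 1)).exists
  refine ⟨N, hN1, not_le.1 fun hcon => not_le.2 hN ?_⟩
  exact EReal.div_nonneg hcon (by exact_mod_cast N.zero_le)

end Moments

variable [IsMarkovKernel q] [∀ i, IsMarkovKernel (p i)]

/-- The particles of time `n + m` descend from the immigrants after time `n` or from the particles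
of time `n`. -/
theorem meanZ_add (n m : ℕ) (ω : ℤ → S) :
    meanZ q p (n + m) ω
      = meanZ q p m (shiftBy n ω) + (meanProd p m (shiftBy n ω)).mulVec (meanZ q p n ω) := by
  induction m with
  | zero => simp [meanZ_zero, meanProd]
  | succ m ih =>
    rw [← add_assoc, meanZ_succ, ih, meanZ_succ, meanProd, ← Matrix.mulVec_mulVec,
      ← Matrix.mulVec_add, meanMatrix_shiftBy, immMean_shiftBy]
    push_cast
    rw [add_comm (m : ℤ) n]
    congr 1
    abel

theorem measurable_norm1_meanZ (n : ℕ) : Measurable fun ω => norm1 (meanZ q p n ω) := by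
  have hm : ∀ j, Measurable fun v : Fin d → ℕ => (v j : ℝ≥0∞) := fun j => Measurable.of_discrete
  exact Finset.measurable_fun_sum _ fun j _ =>
    Measurable.lintegral_kernel ((hm j).comp (measurable_Z 0 n))

theorem lintegral_posLog_meanZ {P : Measure (ℤ → S)} [IsProbabilityMeasure P]
    (hP : MeasurePreserving shift P P) (hA : Subcritical P q p) (n : ℕ) :
    ∫⁻ ω, posLog (norm1 (meanZ q p n ω)) ∂P < ∞ := by
  induction n with
  | zero => simp [meanZ_zero, norm1, posLog]
  | succ n ih =>
    have h : ∀ ω, posLog (norm1 (meanZ q p (n + 1) ω))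
        ≤ posLog (opNorm1 (meanMatrix p n ω))
          + (posLog 2 + (posLog (norm1 (meanZ q p n ω)) + posLog (norm1 (immMean q n ω)))) := by
      intro ω
      rw [meanZ_succ]
      refine (posLog_mono (norm1_mulVec_le _ _)).trans ((posLog_mul_le _ _).trans ?_)
      gcongr
      rw [norm1_add]
      exact posLog_add_le _ _
    refine (lintegral_mono h).trans_lt ?_
    rw [lintegral_add_left (f := fun ω => posLog (opNorm1 (meanMatrix p n ω)))
      (measurable_posLog.comp (measurable_opNorm1_meanMatrix p n)),
      lintegral_add_left measurable_const,
      lintegral_add_left (f := fun ω => posLog (norm1 (meanZ q p n ω)))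
        (measurable_posLog.comp (measurable_norm1_meanZ q p n))]
    simp only [lintegral_const, measure_univ, mul_one]
    exact ENNReal.add_lt_top.2 ⟨lintegral_posLog_meanMatrix hP hA n,
      ENNReal.add_lt_top.2 ⟨posLog_two_lt_top,
        ENNReal.add_lt_top.2 ⟨ih, lintegral_posLog_immMean hP hA n⟩⟩⟩

/-- The quenched mean number of particles at time `0` for the process started from `0` at time
`-n`. -/
def pastMean (n : ℕ) (ω : ℤ → S) : ℝ≥0∞ := norm1 (meanZ q p n (shiftBy (-n) ω))

theorem measurable_pastMean (n : ℕ) : Measurable (pastMean q p n) :=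
  (measurable_norm1_meanZ q p n).comp (measurable_shiftBy _)

theorem pastMean_add_le (n m : ℕ) (ω : ℤ → S) :
    pastMean q p (n + m) ω ≤ pastMean q p m ω
      + opNorm1 (meanProd p m (shiftBy (-m) ω)) * pastMean q p n (shiftBy (-m) ω) := by
  unfold pastMean
  rw [meanZ_add, norm1_add, shiftBy_shiftBy, shiftBy_shiftBy]
  have e1 : (n : ℤ) + -((n + m : ℕ) : ℤ) = -m := by push_cast; ring
  have e2 : -(n : ℤ) + -(m : ℤ) = -((n + m : ℕ) : ℤ) := by push_cast; ring
  rw [e1, e2]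
  gcongr
  exact norm1_mulVec_le _ _

theorem monotone_pastMean (ω : ℤ → S) : Monotone fun n => pastMean q p n ω := by
  refine monotone_nat_of_le_succ fun n => ?_
  unfold pastMean
  rw [add_comm n 1, meanZ_add, norm1_add, shiftBy_shiftBy]
  have e1 : ((1 : ℕ) : ℤ) + -((1 + n : ℕ) : ℤ) = -n := by push_cast; ring
  rw [e1]
  exact le_self_add

/-- Finiteness of the limit of `pastMean` passes from an environment to its shift, since one step
multiplies by a finite matrix. -/
theorem pastMean_succ_shift_le (n : ℕ) (ω : ℤ → S) :
    pastMean q p (n + 1) (shift ω)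
      ≤ opNorm1 (meanMatrix p 0 ω) * (pastMean q p n ω + norm1 (immMean q 0 ω)) := by
  unfold pastMean
  rw [shift_eq_shiftBy, shiftBy_shiftBy, show -((n + 1 : ℕ) : ℤ) + 1 = -n by push_cast; ring,
    meanZ_succ, meanMatrix_shiftBy, immMean_shiftBy, add_neg_cancel, ← norm1_add]
  exact norm1_mulVec_le _ _

/-- The past is cut into blocks of length `N`: the contribution of a block is multiplied by the mean
matrices of the blocks after it. -/
theorem pastMean_mul_le (N k : ℕ) (ω : ℤ → S) :
    pastMean q p (k * N) ω ≤ ∑ j ∈ Finset.range k,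
      (∏ l ∈ Finset.range j,
        opNorm1 (meanProd p N (shiftBy (-N) ((shiftBy (-(N : ℤ)))^[l] ω))))
      * pastMean q p N ((shiftBy (-(N : ℤ)))^[j] ω) := by
  induction k with
  | zero => simp [pastMean, meanZ_zero, norm1]
  | succ k ih =>
    rw [Finset.sum_range_succ, show (k + 1) * N = N + k * N by ring]
    refine (pastMean_add_le q p N (k * N) ω).trans (add_le_add ih ?_)
    rw [shiftBy_iterate,
      show (k : ℤ) * -(N : ℤ) = -((k * N : ℕ) : ℤ) by push_cast; ring]
    gcongr
    exact opNorm1_meanProd_le_prod p N k ω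

/-- The stationary version has finite quenched mean, almost surely. -/
theorem ae_iSup_pastMean_lt_top {P : Measure (ℤ → S)} [IsProbabilityMeasure P]
    (hP : Ergodic shift P) (hA : Subcritical P q p) :
    ∀ᵐ ω ∂P, ⨆ n, pastMean q p n ω < ∞ := by
  have hmp := hP.toMeasurePreserving
  obtain ⟨N, hN1, hN⟩ := exists_eexp_log_meanProd_neg hA
  have hTm := measurePreserving_shiftBy hmp (-N)
  have hfreq : ∃ᵐ ω ∂P, ⨆ n, pastMean q p n ω < ∞ := by
    have hbm := measurable_opNorm1_meanProd p N
    have hJ : ∫⁻ ω, posLog (pastMean q p N ω) ∂P < ∞ := by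
      have h := hTm.lintegral_comp (measurable_posLog.comp (measurable_norm1_meanZ q p N))
      exact h.trans_lt (lintegral_posLog_meanZ q p hmp hA N)
    have hb1 : ∫⁻ ω, posLog (opNorm1 (meanProd p N (shiftBy (-N) ω))) ∂P < ∞ := by
      have h := hTm.lintegral_comp (measurable_posLog.comp hbm)
      exact h.trans_lt (lintegral_posLog_meanProd hmp hA N)
    have hb2 : eexp P (fun ω => ENNReal.log (opNorm1 (meanProd p N (shiftBy (-N) ω)))) < 0 :=
      (eexp_comp hTm hbm.ennreal_log).trans_lt hN
    refine (frequently_tsum_prod_lt_top hTm (hbm.comp (measurable_shiftBy _))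
      (measurable_pastMean q p N) hJ hb1 hb2).mono fun ω hω => (iSup_le fun n => ?_).trans_lt hω
    calc pastMean q p n ω ≤ pastMean q p (n * N) ω :=
          monotone_pastMean q p ω (Nat.le_mul_of_pos_right n hN1)
      _ ≤ _ := pastMean_mul_le q p N n ω
      _ ≤ _ := ENNReal.sum_le_tsum _
  have hm : MeasurableSet {ω | ⨆ n, pastMean q p n ω < ∞} :=
    measurableSet_lt (Measurable.iSup fun n => measurable_pastMean q p n) measurable_const
  have hinv : {ω | ⨆ n, pastMean q p n ω < ∞}
      ≤ᵐ[P] shift ⁻¹' {ω | ⨆ n, pastMean q p n ω < ∞} := by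
    filter_upwards [ae_lt_top (measurable_posLog.comp (measurable_opNorm1_meanMatrix p 0))
        (lintegral_posLog_meanMatrix hmp hA 0).ne,
      ae_lt_top (measurable_posLog.comp (measurable_norm1_immMean q 0))
        (lintegral_posLog_immMean hmp hA 0).ne] with ω h1 h2 hω
    refine lt_of_le_of_lt (iSup_le fun n => ?_) (ENNReal.mul_lt_top (lt_top_of_posLog_lt_top h1)
      (ENNReal.add_lt_top.2 ⟨hω, lt_top_of_posLog_lt_top h2⟩))
    refine (monotone_pastMean q p (shift ω) n.le_succ).trans
      ((pastMean_succ_shift_le q p n ω).trans ?_)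
    gcongr
    exact le_iSup (fun n => pastMean q p n ω) n
  rcases hP.ae_empty_or_univ_of_ae_le_preimage hm.nullMeasurableSet hinv with h | h
  · exact absurd (eventuallyEq_empty.1 h) hfreq
  · exact eventuallyEq_univ.1 h

end Subcritical

/-! ### Positivity of the stationary probability of zero -/

section Positivity

variable {S : Type*} [MeasurableSpace S] {d : ℕ} (q : Kernel S (Fin d → ℕ))
  (p : Fin d → Kernel S (Fin d → ℕ)) [IsMarkovKernel q] [∀ i, IsMarkovKernel (p i)]

theorem exists_pow_le_monomial {r : Fin d → ℝ≥0∞} (hr : ∀ i, r i ≠ 0) :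
    ∃ σ : ℝ≥0∞, σ ≠ 0 ∧ σ ≤ 1 ∧ ∀ v : Fin d → ℕ, σ ^ (∑ i, v i) ≤ monomial r v := by
  refine ⟨∏ i, min 1 (r i), Finset.prod_ne_zero_iff.2 fun i _ => ?_,
    Finset.prod_le_one' fun i _ => min_le_left _ _, fun v => ?_⟩
  · rcases min_choice 1 (r i) with h | h <;> rw [h]
    · exact one_ne_zero
    · exact hr i
  · rw [← Finset.prod_pow_eq_pow_sum]
    refine Finset.prod_le_prod' fun i _ => ?_
    gcongr
    calc ∏ i, min 1 (r i) ≤ ∏ j ∈ {i}, min 1 (r j) :=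
          Finset.prod_le_prod_of_subset_of_le_one' (Finset.subset_univ _)
            fun _ _ _ => min_le_left _ _
      _ ≤ r i := by simp

/-- By Markov's inequality, a bound on the means of `Zₙ` bounds its generating function from
below. -/
theorem exists_pos_le_immPgf {r : Fin d → ℝ≥0∞} (hr : ∀ i, r i ≠ 0) {W : ℝ≥0∞} (hW : W < ∞) :
    ∃ c : ℝ≥0∞, c ≠ 0 ∧ ∀ n ω, norm1 (meanZ q p n ω) ≤ W → c ≤ immPgf q p n ω r := by
  obtain ⟨σ, hσ0, hσ1, hσ⟩ := exists_pow_le_monomial hr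
  -- The population is at most `K` with probability at least `1 / 2`.
  obtain ⟨K, hK⟩ := ENNReal.exists_nat_gt
    (ENNReal.mul_ne_top ENNReal.ofNat_ne_top hW.ne : 2 * W ≠ ∞)
  refine ⟨σ ^ K * 2⁻¹, mul_ne_zero (pow_ne_zero _ hσ0) (by simp), fun n ω hle => ?_⟩
  have hm : ∀ j, Measurable fun v : Fin d → ℕ => (v j : ℝ≥0∞) := fun j => Measurable.of_discrete
  have hsum : Measurable fun t : Trees d => ∑ j, (Z 0 t n j : ℝ≥0∞) :=
    Finset.measurable_fun_sum _ fun j _ => (hm j).comp (measurable_Z 0 n)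
  set B : Set (Trees d) := {t | (K : ℝ≥0∞) ≤ ∑ j, (Z 0 t n j : ℝ≥0∞)} with hB
  have hBm : MeasurableSet B := measurableSet_le measurable_const hsum
  have hK0 : (K : ℝ≥0∞) ≠ 0 := (pos_of_gt hK).ne'
  have hmean : ∫⁻ t, ∑ j, (Z 0 t n j : ℝ≥0∞) ∂quenched q p ω = norm1 (meanZ q p n ω) :=
    lintegral_finsetSum _ fun j _ => (hm j).comp (measurable_Z 0 n)
  have hmarkov : quenched q p ω B ≤ 2⁻¹ := by
    refine (meas_ge_le_lintegral_div hsum.aemeasurable hK0 (ENNReal.natCast_ne_top K)).trans ?_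
    rw [hmean]
    refine ENNReal.div_le_of_le_mul (hle.trans ?_)
    rw [mul_comm, ← div_eq_mul_inv, ENNReal.le_div_iff_mul_le (by simp) (by simp), mul_comm]
    exact hK.le
  have hcompl : 2⁻¹ ≤ quenched q p ω Bᶜ := by
    rw [prob_compl_eq_one_sub hBm]
    calc (2⁻¹ : ℝ≥0∞) = 1 - 2⁻¹ := ENNReal.one_sub_inv_two.symm
      _ ≤ _ := tsub_le_tsub_left hmarkov 1
  calc σ ^ K * 2⁻¹ ≤ σ ^ K * quenched q p ω Bᶜ := by gcongr
    _ = ∫⁻ _ in Bᶜ, σ ^ K ∂quenched q p ω := by rw [setLIntegral_const]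
    _ ≤ ∫⁻ t in Bᶜ, monomial r (Z 0 t n) ∂quenched q p ω := by
        refine setLIntegral_mono' hBm.compl fun t ht => ?_
        refine le_trans (pow_le_pow_right_of_le_one' hσ1 ?_) (hσ _)
        have h : ¬(K : ℝ≥0∞) ≤ ∑ j, (Z 0 t n j : ℝ≥0∞) := ht
        exact_mod_cast (not_le.1 h).le
    _ ≤ ∫⁻ t, monomial r (Z 0 t n) ∂quenched q p ω := setLIntegral_le_lintegral _ _
    _ = immPgf q p n ω r := by rw [lintegral_monomial_Z, monomial_zero, mul_one]

/-- If the stationary version has finite mean at time `0` and the population may die out by time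
`m`, then the stationary version may vanish at time `m`. -/
theorem waveQuenched_iInter_deadWaves_ne_zero {ω : ℤ → S} (hω : ⨆ n, pastMean q p n ω < ∞)
    {m : ℕ} (hm : quenched q p ω {t | Z 1 t m = 0} ≠ 0) :
    waveQuenched q p (shiftBy m ω) (⋂ n, deadWaves d n) ≠ 0 := by
  rw [quenched_Z_eq_zero] at hm
  have hr : ∀ i, treePgf p m ω 0 i ≠ 0 := fun i h =>
    right_ne_zero_of_mul hm (Finset.prod_eq_zero (Finset.mem_univ i) (by simp [h]))
  obtain ⟨c, hc, hle⟩ := exists_pos_le_immPgf q p hr hω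
  have hpos : c * immPgf q p m ω 0 ≠ 0 := mul_ne_zero hc (left_ne_zero_of_mul hm)
  refine fun h0 => hpos (le_antisymm (h0 ▸ ?_) zero_le)
  refine ge_of_tendsto (tendsto_measure_iInter_atTop
    (fun n => (measurableSet_deadWaves n).nullMeasurableSet) antitone_deadWaves
    ⟨0, measure_ne_top _ _⟩) ?_
  -- Seen from time `m`, the last `k = n + m` immigrations start at time `-n`.
  filter_upwards [eventually_ge_atTop m] with k hk
  obtain ⟨n, rfl⟩ : ∃ n, k = n + m := ⟨k - m, by omega⟩
  rw [Function.comp_apply, waveQuenched_deadWaves, shiftBy_shiftBy,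
    show -((n + m : ℕ) : ℤ) + (m : ℤ) = -n by push_cast; ring, immPgf_add, shiftBy_shiftBy,
    add_neg_cancel, shiftBy_zero]
  gcongr
  exact hle n _ (le_iSup (fun n => pastMean q p n ω) n)

theorem stationaryProb_zero_ne_zero {P : Measure (ℤ → S)} [IsProbabilityMeasure P]
    (hP : Ergodic shift P) (hA : Subcritical P q p) {m : ℕ}
    (hm : 0 < P {ω | 0 < quenched q p ω {t | Z 1 t m = 0}}) : stationaryProb P q p 0 ≠ 0 := by
  have hms := MeasurableSet.iInter (measurableSet_deadWaves (d := d))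
  have hmeas := Kernel.measurable_coe (waveQuenched q p) hms
  rw [stationaryProb_zero, ← (measurePreserving_shiftBy hP.toMeasurePreserving m).lintegral_comp
    hmeas, Ne, lintegral_eq_zero_iff (f := fun ω => waveQuenched q p (shiftBy m ω) _)
      (hmeas.comp (measurable_shiftBy _))]
  intro h0
  have hfreq : ∃ᵐ ω ∂P, 0 < quenched q p ω {t | Z 1 t m = 0} := frequently_ae_iff.2 hm.ne'
  obtain ⟨ω, hω1, hω2, hω3⟩ :=
    (hfreq.and_eventually ((ae_iSup_pastMean_lt_top q p hP hA).and h0)).exists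
  exact waveQuenched_iInter_deadWaves_ne_zero q p hω2 hω1.ne' hω3

end Positivity

end MBPIRE

end

theorem theorem1p5 {S : Type*} [MeasurableSpace S] {d : ℕ} (hd : 1 ≤ d)
    (P : Measure (ℤ → S)) [IsProbabilityMeasure P] (hP : Ergodic (MBPIRE.shift (S := S)) P)
    (q : Kernel S (Fin d → ℕ)) [IsMarkovKernel q]
    (p : Fin d → Kernel S (Fin d → ℕ)) [∀ i, IsMarkovKernel (p i)]
    (hA : MBPIRE.Subcritical P q p)
    (h110 : ∃ m : ℕ, 1 ≤ m ∧
      0 < P {ω | 0 < MBPIRE.quenched q p ω {t | MBPIRE.Z 1 t m = 0}}) :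
    (∀ᵐ x ∂(MBPIRE.annealed P q p), ∃ᶠ n in atTop, MBPIRE.Z 0 x.2 n = 0) ∧
    ((∀ᵐ ω ∂P, 0 < MBPIRE.quenched q p ω {t | MBPIRE.Z 1 t 1 = 0}) →
      ∃ μ : ℝ, 0 < μ ∧ μ = 1 / (MBPIRE.stationaryProb P q p 0).toReal ∧
        ∀ᵐ x ∂(MBPIRE.annealed P q p),
          Tendsto (fun n : ℕ => (MBPIRE.regenTime x.2 n : ℝ≥0∞) / (n : ℝ≥0∞)) atTop
            (𝓝 (ENNReal.ofReal μ))) := by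
  obtain ⟨m, -, hm⟩ := h110
  have hpos : 0 < (MBPIRE.stationaryProb P q p 0).toReal :=
    ENNReal.toReal_pos (MBPIRE.stationaryProb_zero_ne_zero q p hP hA hm)
      (ne_top_of_le_ne_top ENNReal.one_ne_top (MBPIRE.stationaryProb_le_one q p))
  have hfreq := MBPIRE.tendsto_count_zero q p hP
  refine ⟨?_, fun _ => ⟨_, one_div_pos.2 hpos, rfl, ?_⟩⟩
  · filter_upwards [hfreq] with x hx
    exact MBPIRE.frequently_of_tendsto_count hpos hx
  · filter_upwards [hfreq] with x hx
    exact MBPIRE.tendsto_regenTime_div hpos hx
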